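/- Let $k,m\ge 1$ and $l\ge 0$ be integers with $k=m+l$. Let $(R_\alpha)_{\alpha\in J}$ be a family of (affine) planes in $\mathbb R^k$ of common dimension $l$, indexed by an infinite countable set $J$. For $\delta\ge 0$ put $\Delta(R_\alpha,\delta)=\{x\in\mathbb R^k:\operatorname{dist}(x,R_\alpha)<\delta\}$, where $\operatorname{dist}$ is the Euclidean distance. Let $\Upsilon:J\to[0,\infty)$, $\alpha\mapsto\Upsilon_\alpha$, be such that $\{\alpha\in J:\Upsilon_\alpha>\varepsilon\}$ is finite for every $\varepsilon>0$. For every function $\Phi:J\to[0,\infty)$ let $$\Lambda(\Phi)=\{x\in\mathbb R^k: x\in\Delta(R_\alpha,\Phi_\alpha)\text{ for infinitely many }\alpha\in J\}.$$ A dimension function is a continuous, non-decreasing function $f:[0,\infty)\to[0,\infty)$ with $f(r)\to 0$ as $r\to 0$. For such $f$ and $F\subset\mathbb R^k$, the Hausdorff $f$-measure is $\mathcal H^f(F)=\sup_{\rho>0}\inf\sum_i f(r_i)$, where the infimum is taken over all countable covers of $F$ by balls of radii $r_i\le\rho$; $\mathcal H^k$ denotes $\mathcal H^f$ with $f(r)=r^k$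 (a constant multiple of Lebesgue measure). Let $V$ be a linear subspace of $\mathbb R^k$ with $\dim V=m$ such that (i) $V\cap R_\alpha\neq\emptyset$ for all $\alpha\in J$; (ii) $\sup_{\alpha\in J}\operatorname{diam}\big(V\cap\Delta(R_\alpha,1)\big)<\infty$. Let $f$ and $g$ be dimension functions with $g(r)=r^{-l}f(r)$ for all $r>0$, such that $r\mapsto r^{-k}f(r)$ is monotonic on $(0,\infty)$, and let $\Omega$ be a ball in $\mathbb R^k$. Suppose that for every ball $B\subset\Omega$ $$\mathcal H^k\big(B\cap\Lambda(g(\Upsilon)^{1/m})\big)=\mathcal H^k(B),$$ where $g(\Upsilon)^{1/m}$ denotes the function $\alpha\mapsto g(\Upsilon_\alpha)^{1/m}$. Then for every ball $B\subset\Omega$ $$\mathcal H^f\big(B\cap\Lambda(\Upsilon)\big)=\mathcal H^f(B).$$ -/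

import Mathlib

open scoped NNReal ENNReal Topology

namespace PlaneMTP

/-- A dimension function: a continuous, non-decreasing `f : [0, ∞) → [0, ∞)` with `f r → 0` as
`r → 0`. -/
structure IsDimensionFunction (f : ℝ≥0 → ℝ≥0) : Prop where
  continuous : Continuous f
  monotone : Monotone f
  tendsto_zero : Filter.Tendsto f (𝓝[>] 0) (𝓝 0)

/-- `H^f_ρ (F)`: the infimum of `∑ f (r i)` over all countable covers of `F` by balls of radius
`r i ≤ ρ`. A ball of radius `0` in the sequence is empty (and costs `f 0 = 0` for a dimension
function), so that finite covers are included. -/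
noncomputable def hausdorffContent {E : Type*} [PseudoMetricSpace E] (f : ℝ≥0 → ℝ≥0) (ρ : ℝ≥0)
    (F : Set E) : ℝ≥0∞ :=
  ⨅ (c : ℕ → E) (r : ℕ → ℝ≥0) (_ : ∀ i, r i ≤ ρ) (_ : F ⊆ ⋃ i, Metric.ball (c i) (r i)),
    ∑' i, (f (r i) : ℝ≥0∞)

/-- The Hausdorff `f`-measure `H^f (F) = sup_{ρ > 0} H^f_ρ (F)`, defined through covers by balls
and their radii. -/
noncomputable def hausdorffMeas {E : Type*} [PseudoMetricSpace E] (f : ℝ≥0 → ℝ≥0)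
    (F : Set E) : ℝ≥0∞ :=
  ⨆ (ρ : ℝ≥0) (_ : 0 < ρ), hausdorffContent f ρ F

/-- A set is a ball if it is an open or a closed ball of positive radius. -/
def IsBall {E : Type*} [PseudoMetricSpace E] (B : Set E) : Prop :=
  ∃ (x : E) (r : ℝ), 0 < r ∧ (B = Metric.ball x r ∨ B = Metric.closedBall x r)

/-- `Λ(Υ)`: the points lying in the open `Υ α`-neighbourhood of `R α` for infinitely many `α`. -/
def limsupSet {E : Type*} [PseudoMetricSpace E] {J : Type*} (R : J → Set E) (Υ : J → ℝ≥0) :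
    Set E :=
  {x | {α : J | x ∈ Metric.thickening (Υ α) (R α)}.Infinite}

end PlaneMTP

open PlaneMTP

/-! Write `a` for `Υ` and `b` for `g(Υ)^(1/m)`, so `b ^ m = g a`. Up to the volume of the unit ball,
`H^k` is Lebesgue measure, so the hypothesis says that almost every point of `B` lies in `Λ(b)`.
There are two regimes.

If `f r ≤ K * r ^ k` near `0`, then `b ≤ M * a` up to finitely many indices. Scaling the radii by a
constant changes a limsup set of neighbourhoods only by a null set, so `Λ(a)` is also full in `B`.
Lebesgue null sets are `H^f`-null, which settles this case.

Otherwise monotonicity forces `r ^ (-k) * f r` to be non-increasing and to tend to infinity at `0`,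
and both sides are infinite. A mass distribution argument shows this. Disjoint balls `D` of radius
`2b` centred within `b` of a plane carry almost all of a measure `μ`; the mass of each is spread
uniformly over the slab of half-width `a/2` in it (`exists_isRedistribution`). Since `b ^ m = g a`,
the new measure gives small balls mass `O(f r)` (`volume_slab_inter_ball_mul_le`), with a constant
proportional to the density bound of `μ`. That constant could grow along an iteration, so many
redistributions at widely separated scales are averaged: each radius is bad for at most one of them,
and the bound barely deteriorates (`exists_averaged_redistribution`). Iterating inside nested
compact sets bounds `H^f` below by an arbitrarily large number
(`hausdorffMeas_inter_iInter_eq_top`). -/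

namespace PlaneMTP

open MeasureTheory Metric Set Filter Module

/-! ### Comparison of Hausdorff measures with Lebesgue measure -/

section HausdorffVolume

variable {E : Type*} [NormedAddCommGroup E] [InnerProductSpace ℝ E] [FiniteDimensional ℝ E]
  [MeasurableSpace E] [BorelSpace E]

theorem volume_unitBall_ne_zero : volume (ball (0 : E) 1) ≠ 0 :=
  (measure_ball_pos _ _ one_pos).ne'

theorem volume_unitBall_ne_top : volume (ball (0 : E) 1) ≠ ∞ := measure_ball_lt_top.ne

theorem volume_ball_nnreal [Nontrivial E] (x : E) (r : ℝ≥0) :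
    volume (ball x r) = (r : ℝ≥0∞) ^ finrank ℝ E * volume (ball (0 : E) 1) := by
  rw [Measure.addHaar_ball _ _ r.coe_nonneg, ENNReal.ofReal_pow r.coe_nonneg, ENNReal.ofReal_coe_nnreal]

theorem volume_closedBall_nnreal [Nontrivial E] (x : E) (r : ℝ≥0) :
    volume (closedBall x r) = (r : ℝ≥0∞) ^ finrank ℝ E * volume (ball (0 : E) 1) := by
  rw [Measure.addHaar_closedBall_eq_addHaar_ball, volume_ball_nnreal]

theorem hausdorffContent_le_tsum {X ι : Type*} [PseudoMetricSpace X] [Nonempty X] [Countable ι]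
    {f : ℝ≥0 → ℝ≥0} (h0 : f 0 = 0) {ρ : ℝ≥0} {F : Set X} (c : ι → X) (r : ι → ℝ≥0)
    (hr : ∀ i, r i ≤ ρ) (hF : F ⊆ ⋃ i, ball (c i) (r i)) :
    hausdorffContent f ρ F ≤ ∑' i, (f (r i) : ℝ≥0∞) := by
  obtain ⟨e, he⟩ := exists_injective_nat ι
  let c' : ℕ → X := Function.extend e c (fun _ => Classical.arbitrary X)
  let r' : ℕ → ℝ≥0 := Function.extend e r 0
  have hc' : ∀ i, c' (e i) = c i := fun i => he.extend_apply _ _ _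
  have hr' : ∀ i, r' (e i) = r i := fun i => he.extend_apply _ _ _
  have hr0 : ∀ n, n ∉ range e → r' n = 0 := fun n hn =>
    Function.extend_apply' _ _ _ (by simpa using hn)
  have hle : ∀ n, r' n ≤ ρ := by
    intro n
    by_cases hn : n ∈ range e
    · obtain ⟨i, rfl⟩ := hn
      rw [hr']; exact hr i
    · rw [hr0 n hn]; exact zero_le
  have hcov : F ⊆ ⋃ n, ball (c' n) (r' n) := by
    intro x hx
    obtain ⟨i, hi⟩ := mem_iUnion.1 (hF hx)
    refine mem_iUnion.2 ⟨e i, ?_⟩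
    rwa [hc', hr']
  have hsum : ∑' i, (f (r i) : ℝ≥0∞) = ∑' n, (f (r' n) : ℝ≥0∞) := by
    rw [← he.tsum_eq (f := fun n => (f (r' n) : ℝ≥0∞))]
    · simp_rw [hr']
    · intro n hn
      by_contra h
      simp [hr0 n h, h0] at hn
  rw [hsum]
  exact iInf_le_of_le c' (iInf_le_of_le r' (iInf_le_of_le hle (iInf_le_of_le hcov le_rfl)))

theorem mul_volume_le_hausdorffMeas [Nontrivial E] {f : ℝ≥0 → ℝ≥0} {c ρ : ℝ≥0} (hρ : 0 < ρ)
    (h : ∀ r, 0 < r → r ≤ ρ → c * r ^ finrank ℝ E ≤ f r) (F : Set E) :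
    c * volume F ≤ volume (ball (0 : E) 1) * hausdorffMeas f F := by
  set ω := volume (ball (0 : E) 1) with hω
  have hω0 : ω ≠ 0 := volume_unitBall_ne_zero
  have hωt : ω ≠ ∞ := volume_unitBall_ne_top
  rw [mul_comm ω, ← ENNReal.div_le_iff hω0 hωt]
  refine le_trans ?_ (le_iSup₂_of_le ρ hρ le_rfl)
  refine le_iInf fun x => le_iInf fun r => le_iInf fun hr => le_iInf fun hF => ?_
  rw [ENNReal.div_le_iff hω0 hωt, ← ENNReal.tsum_mul_right]
  calc c * volume F ≤ c * ∑' i, volume (ball (x i) (r i)) := by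
        gcongr
        exact (measure_mono hF).trans (measure_iUnion_le _)
    _ = ∑' i, c * volume (ball (x i) (r i)) := ENNReal.tsum_mul_left.symm
    _ ≤ _ := by
        refine ENNReal.tsum_le_tsum fun i => ?_
        rw [volume_ball_nnreal, ← mul_assoc]
        gcongr
        rcases eq_or_lt_of_le (zero_le (a := r i)) with h0 | h0
        · rw [← h0]
          simp [finrank_pos.ne']
        · exact_mod_cast h _ h0 (hr i)

/-- Besicovitch gives covers by small closed balls of total volume at most `volume F + ε`; enlarging
the radii by `1 + ε` makes them open, and then `ε → 0`. -/
theorem hausdorffMeas_le_mul_volume [Nontrivial E] {f : ℝ≥0 → ℝ≥0} (h0 : f 0 = 0) {c ρ : ℝ≥0}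
    (hρ : 0 < ρ) (h : ∀ r, 0 < r → r ≤ ρ → f r ≤ c * r ^ finrank ℝ E) {F : Set E}
    (hF : volume F ≠ ∞) :
    volume (ball (0 : E) 1) * hausdorffMeas f F ≤ c * volume F := by
  set ω := volume (ball (0 : E) 1) with hω
  have hω0 : ω ≠ 0 := volume_unitBall_ne_zero
  have hωt : ω ≠ ∞ := volume_unitBall_ne_top
  rw [mul_comm ω, ← ENNReal.le_div_iff_mul_le (Or.inl hω0) (Or.inl hωt)]
  refine iSup₂_le fun σ hσ => ?_
  rw [ENNReal.le_div_iff_mul_le (Or.inl hω0) (Or.inl hωt)]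
  have key : ∀ ε : ℝ≥0, 0 < ε → hausdorffContent f σ F * ω ≤
      ((c * (1 + ε) ^ finrank ℝ E * ((volume F).toNNReal + ε) : ℝ≥0) : ℝ≥0∞) := by
    intro ε hε
    set τ : ℝ≥0 := min ρ σ / (1 + ε) with hτ
    have hτ0 : 0 < τ := div_pos (lt_min hρ hσ) (by positivity)
    obtain ⟨t, r, htc, -, hrt, hcov, hsum⟩ :=
      Besicovitch.exists_closedBall_covering_tsum_measure_le (volume : Measure E)
        (ε := ε) (by simpa using hε.ne') (fun _ => Ioo (0 : ℝ) τ) F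
        (fun x _ δ hδ => by
          obtain ⟨a, ha⟩ := exists_between (lt_min (NNReal.coe_pos.2 hτ0) hδ)
          exact ⟨a, ⟨ha.1, ha.2.trans_le (min_le_left _ _)⟩, ha.1, ha.2.trans_le (min_le_right _ _)⟩)
    have : Countable t := htc.to_subtype
    let r' : t → ℝ≥0 := fun x => (r x).toNNReal
    have hr' : ∀ x : t, (r' x : ℝ) = r x := fun x => Real.coe_toNNReal _ (hrt x x.2).1.le
    have hr'0 : ∀ x : t, 0 < r' x := fun x => Real.toNNReal_pos.2 (hrt x x.2).1
    have hr'τ : ∀ x : t, (1 + ε) * r' x ≤ min ρ σ := by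
      intro x
      have h1 : r' x ≤ τ := by
        rw [← NNReal.coe_le_coe, hr']; exact (hrt x x.2).2.le
      calc (1 + ε) * r' x ≤ (1 + ε) * τ := by gcongr
        _ = min ρ σ := by rw [hτ]; field_simp
    have hcov' : F ⊆ ⋃ x : t, ball (x : E) ((1 + ε) * r' x : ℝ≥0) := by
      intro y hy
      obtain ⟨x, hxt, hx⟩ := mem_iUnion₂.1 (hcov hy)
      refine mem_iUnion.2 ⟨⟨x, hxt⟩, ?_⟩
      refine closedBall_subset_ball ?_ hx
      have := hr'0 ⟨x, hxt⟩
      rw [← hr' ⟨x, hxt⟩, NNReal.coe_lt_coe]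
      exact lt_mul_of_one_lt_left this (lt_add_of_pos_right _ hε)
    have h1 := hausdorffContent_le_tsum h0 (ρ := σ) (fun x : t => (x : E))
      (fun x => (1 + ε) * r' x) (fun x => (hr'τ x).trans (min_le_right _ _)) hcov'
    calc hausdorffContent f σ F * ω
        ≤ (∑' x : t, (f ((1 + ε) * r' x) : ℝ≥0∞)) * ω := by gcongr
      _ = ∑' x : t, (f ((1 + ε) * r' x) : ℝ≥0∞) * ω := ENNReal.tsum_mul_right.symm
      _ ≤ ∑' x : t, ((c * (1 + ε) ^ finrank ℝ E : ℝ≥0) : ℝ≥0∞) *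
            volume (closedBall (x : E) (r x)) := by
          refine ENNReal.tsum_le_tsum fun x => ?_
          rw [← hr' x, volume_closedBall_nnreal, ← mul_assoc]
          gcongr
          have := h ((1 + ε) * r' x) (mul_pos (by positivity) (hr'0 x))
            ((hr'τ x).trans (min_le_left _ _))
          rw [mul_pow, ← mul_assoc] at this
          exact_mod_cast this
      _ = ((c * (1 + ε) ^ finrank ℝ E : ℝ≥0) : ℝ≥0∞) *
            ∑' x : t, volume (closedBall (x : E) (r x)) := ENNReal.tsum_mul_left
      _ ≤ ((c * (1 + ε) ^ finrank ℝ E : ℝ≥0) : ℝ≥0∞) * (volume F + ε) := by gcongr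
      _ = _ := by
          conv_lhs => rw [← ENNReal.coe_toNNReal hF]
          push_cast
          rfl
  have hcont : Continuous fun ε : ℝ≥0 =>
      ((c * (1 + ε) ^ finrank ℝ E * ((volume F).toNNReal + ε) : ℝ≥0) : ℝ≥0∞) :=
    ENNReal.continuous_coe.comp (by fun_prop)
  have hlim := (hcont.tendsto 0).mono_left (nhdsWithin_le_nhds (s := Ioi 0))
  have := ge_of_tendsto hlim (eventually_nhdsWithin_of_forall fun ε hε => key ε hε)
  simpa [ENNReal.coe_toNNReal hF] using this

end HausdorffVolume

/-! ### Volume of a ball intersected with a neighbourhood of a plane -/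

section Strips

open scoped Pointwise

variable {E : Type*} [NormedAddCommGroup E] [InnerProductSpace ℝ E] [FiniteDimensional ℝ E]

/-- The linear map scaling `W` by `r` and `Wᗮ` by `s`. -/
noncomputable def stretch (W : Submodule ℝ E) (r s : ℝ) : E →ₗ[ℝ] E :=
  ((r • W.starProjection + s • Wᗮ.starProjection : E →L[ℝ] E) : E →ₗ[ℝ] E)

theorem stretch_apply (W : Submodule ℝ E) (r s : ℝ) (u : E) :
    stretch W r s u = r • W.starProjection u + s • Wᗮ.starProjection u := rfl

theorem det_stretch (W : Submodule ℝ E) (r s : ℝ) :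
    LinearMap.det (stretch W r s) = r ^ finrank ℝ W * s ^ finrank ℝ Wᗮ := by
  let e := W.prodEquivOfIsCompl Wᗮ W.isCompl_orthogonal
  have h : stretch W r s = (e : (W × Wᗮ) →ₗ[ℝ] E) ∘ₗ
      (LinearMap.prodMap (r • LinearMap.id) (s • LinearMap.id)) ∘ₗ (e.symm : E →ₗ[ℝ] (W × Wᗮ)) := by
    ext u
    obtain ⟨⟨w, v⟩, rfl⟩ := e.surjective u
    have h1 : W.starProjection (v : E) = 0 :=
      (Submodule.starProjection_apply_eq_zero_iff W).2 v.2
    have h2 : Wᗮ.starProjection (w : E) = 0 :=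
      (Submodule.starProjection_apply_eq_zero_iff Wᗮ).2 (W.le_orthogonal_orthogonal w.2)
    have h3 : W.starProjection (w : E) = w := Submodule.starProjection_eq_self_iff.2 w.2
    have h4 : Wᗮ.starProjection (v : E) = v := Submodule.starProjection_eq_self_iff.2 v.2
    simp [stretch_apply, e, Submodule.coe_prodEquivOfIsCompl', h1, h3]
  rw [h, LinearMap.det_conj, LinearMap.det_prodMap]
  simp

variable [MeasurableSpace E] [BorelSpace E]

theorem volume_vadd_stretch_image (W : Submodule ℝ E) (r s : ℝ≥0) (q : E) (A : Set E) :
    volume (q +ᵥ stretch W r s '' A) =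
      (r : ℝ≥0∞) ^ finrank ℝ W * (s : ℝ≥0∞) ^ finrank ℝ Wᗮ * volume A := by
  rw [measure_vadd, Measure.addHaar_image_linearMap, det_stretch, abs_of_nonneg (by positivity),
    ENNReal.ofReal_mul (by positivity), ENNReal.ofReal_pow r.coe_nonneg,
    ENNReal.ofReal_pow s.coe_nonneg, ENNReal.ofReal_coe_nnreal, ENNReal.ofReal_coe_nnreal]

/-- The components of a point along the plane and across it are controlled separately by `r` and
`s`. After rescaling each has norm below `1`, so the intersection lies in a translate of the
stretched ball of radius `2`. -/
theorem volume_ball_inter_thickening_le [Nontrivial E] (P : AffineSubspace ℝ E) (y : E)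
    {r s : ℝ≥0} (hr : 0 < r) (hs : 0 < s) :
    volume (ball y r ∩ thickening s (P : Set E)) ≤
      (r : ℝ≥0∞) ^ finrank ℝ P.direction * (s : ℝ≥0∞) ^ finrank ℝ P.directionᗮ *
        (2 ^ finrank ℝ E * volume (ball (0 : E) 1)) := by
  rcases (P : Set E).eq_empty_or_nonempty with hP | ⟨q, hq⟩
  · simp [hP]
  set W := P.direction
  have h2 : (2 : ℝ≥0∞) ^ finrank ℝ E * volume (ball (0 : E) 1) = volume (ball (0 : E) 2) := by
    simpa using (volume_ball_nnreal (0 : E) 2).symm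
  rw [h2, ← volume_vadd_stretch_image W r s (q + W.starProjection (y - q))]
  refine measure_mono ?_
  rintro z ⟨hzy, hzP⟩
  obtain ⟨p, hp, hzp⟩ := mem_thickening_iff.1 hzP
  have hpq : p - q ∈ W := AffineSubspace.vsub_mem_direction hp hq
  have hw : ‖W.starProjection (z - y)‖ < r :=
    (W.norm_starProjection_apply_le _).trans_lt (by rwa [← dist_eq_norm])
  have hv : ‖Wᗮ.starProjection (z - q)‖ < s := by
    have : Wᗮ.starProjection (z - q) = Wᗮ.starProjection (z - p) := by
      rw [← sub_add_sub_cancel z p q, map_add,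
        (Submodule.starProjection_apply_eq_zero_iff Wᗮ).2 (W.le_orthogonal_orthogonal hpq),
        add_zero]
    rw [this]
    exact (Wᗮ.norm_starProjection_apply_le _).trans_lt (by rwa [← dist_eq_norm])
  set w := W.starProjection (z - y) with hwd
  set v := Wᗮ.starProjection (z - q) with hvd
  have hwW : w ∈ W := Submodule.starProjection_apply_mem _ _
  have hvW : v ∈ Wᗮ := Submodule.starProjection_apply_mem _ _
  have h1 : W.starProjection v = 0 := (Submodule.starProjection_apply_eq_zero_iff W).2 hvW
  have h2 : Wᗮ.starProjection w = 0 :=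
    (Submodule.starProjection_apply_eq_zero_iff Wᗮ).2 (W.le_orthogonal_orthogonal hwW)
  have h3 : W.starProjection w = w := Submodule.starProjection_eq_self_iff.2 hwW
  have h4 : Wᗮ.starProjection v = v := Submodule.starProjection_eq_self_iff.2 hvW
  have hr' : (0 : ℝ) < r := hr
  have hs' : (0 : ℝ) < s := hs
  refine mem_vadd_set.2 ⟨w + v, ⟨(r : ℝ)⁻¹ • w + (s : ℝ)⁻¹ • v, ?_, ?_⟩, ?_⟩
  · rw [mem_ball_zero_iff]
    have e1 : ‖(r : ℝ)⁻¹ • w‖ < 1 := by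
      rw [norm_smul, Real.norm_of_nonneg (by positivity), inv_mul_lt_one₀ hr']; exact hw
    have e2 : ‖(s : ℝ)⁻¹ • v‖ < 1 := by
      rw [norm_smul, Real.norm_of_nonneg (by positivity), inv_mul_lt_one₀ hs']; exact hv
    linarith [norm_add_le ((r : ℝ)⁻¹ • w) ((s : ℝ)⁻¹ • v)]
  · simp [stretch_apply, h1, h3, hr'.ne', hs'.ne']
  · have h5 : W.starProjection (z - q) + Wᗮ.starProjection (z - q) = z - q := by
      simp
    have h6 : W.starProjection (y - q) + w = W.starProjection (z - q) := by
      rw [hwd, ← map_add]; congr 1; abel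
    rw [vadd_eq_add, add_assoc, ← add_assoc _ w v, h6, hvd, h5]
    abel

theorem le_volume_ball_inter_thickening [Nontrivial E] (P : AffineSubspace ℝ E) {p : E}
    (hp : p ∈ P) {r s : ℝ≥0} (hr : 0 < r) (hs : 0 < s) (hsr : s ≤ r) :
    (r : ℝ≥0∞) ^ finrank ℝ P.direction * (s : ℝ≥0∞) ^ finrank ℝ P.directionᗮ *
        ((2⁻¹ : ℝ≥0) ^ finrank ℝ E * volume (ball (0 : E) 1)) ≤
      volume (ball p r ∩ thickening s (P : Set E)) := by
  set W := P.direction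
  have hr' : (0 : ℝ) < r := hr
  have hs' : (0 : ℝ) < s := hs
  have hsr' : (s : ℝ) ≤ r := hsr
  rw [← volume_ball_nnreal (0 : E) 2⁻¹, ← volume_vadd_stretch_image W r s p]
  refine measure_mono ?_
  rintro _ ⟨_, ⟨u, hu, rfl⟩, rfl⟩
  have hu' : ‖u‖ < 2⁻¹ := by simpa using hu
  have hw := W.norm_starProjection_apply_le u
  have hv := Wᗮ.norm_starProjection_apply_le u
  simp only [vadd_eq_add, stretch_apply]
  have n1 : ‖(r : ℝ) • W.starProjection u‖ ≤ r * ‖u‖ := by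
    rw [norm_smul, Real.norm_of_nonneg hr'.le]; gcongr
  have n2 : ‖(s : ℝ) • Wᗮ.starProjection u‖ ≤ s * ‖u‖ := by
    rw [norm_smul, Real.norm_of_nonneg hs'.le]; gcongr
  refine ⟨?_, mem_thickening_iff.2 ⟨(r : ℝ) • W.starProjection u +ᵥ p,
    AffineSubspace.vadd_mem_of_mem_direction
      (W.smul_mem _ (Submodule.starProjection_apply_mem _ _)) hp, ?_⟩⟩
  · rw [mem_ball, dist_eq_norm, add_sub_cancel_left]
    refine (norm_add_le _ _).trans_lt ?_
    nlinarith [norm_nonneg u]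
  · rw [dist_eq_norm, vadd_eq_add, ← add_assoc, add_comm p, add_sub_cancel_left]
    nlinarith [norm_nonneg u]

end Strips

/-! ### Moving mass from balls onto slabs -/

section Redistribution

variable {E : Type*} [NormedAddCommGroup E] [InnerProductSpace ℝ E] [FiniteDimensional ℝ E]
  [MeasurableSpace E] [BorelSpace E]

/-- The plane has a point `p` within `b` of `x`, and `ball p b` fits in the ball of radius `2 * b`
about `x`. -/
theorem le_volume_ball_two_mul_inter_thickening [Nontrivial E] (P : AffineSubspace ℝ E) {x : E}
    {a b : ℝ≥0} (ha : 0 < a) (hab : a ≤ b) (hx : x ∈ thickening b (P : Set E)) :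
    (b : ℝ≥0∞) ^ finrank ℝ P.direction * ((a / 2 : ℝ≥0) : ℝ≥0∞) ^ finrank ℝ P.directionᗮ *
        ((2⁻¹ : ℝ≥0) ^ finrank ℝ E * volume (ball (0 : E) 1)) ≤
      volume (ball x (2 * b : ℝ≥0) ∩ thickening (a / 2 : ℝ≥0) (P : Set E)) := by
  obtain ⟨p, hp, hxp⟩ := mem_thickening_iff.1 hx
  have ha2 : a / 2 ≤ a := NNReal.half_le_self a
  refine (le_volume_ball_inter_thickening P hp (ha.trans_le hab) (half_pos ha)
    (ha2.trans hab)).trans (measure_mono ?_)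
  refine inter_subset_inter_left _ (ball_subset_ball' ?_)
  rw [dist_comm]
  push_cast
  linarith

/-- A ball of radius `r` meeting the ball `D` of radius `ρ ≥ r` has a dilate that covers a
proportion of a ball of radius `r` inside `D`. -/
theorem le_volume_closedBall_inter_ball [Nontrivial E] {x y z : E} {ρ r : ℝ≥0} (hr : 0 < r)
    (hrρ : r ≤ ρ) (hzx : z ∈ ball x ρ) (hzy : z ∈ ball y r) :
    ((r / 2 : ℝ≥0) : ℝ≥0∞) ^ finrank ℝ E * volume (ball (0 : E) 1) ≤
      volume (closedBall x ρ ∩ ball y (3 * r : ℝ≥0)) := by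
  have hr' : (0 : ℝ) < r := hr
  have hrρ' : (r : ℝ) ≤ ρ := hrρ
  have hρ' : (0 : ℝ) < ρ := hr'.trans_le hrρ'
  -- With this `τ`, moving `z` towards `x` costs at most `r / 2` and leaves room for a ball of
  -- radius `r / 2` about `w` inside the ball about `x`.
  set τ : ℝ := r / (2 * ρ) with hτ
  have hτ0 : 0 ≤ τ := by positivity
  have hτρ : τ * ρ = r / 2 := by rw [hτ]; field_simp
  have hτ1 : τ ≤ 1 := by
    rw [hτ, div_le_one (by positivity)]; linarith
  set w : E := z + τ • (x - z) with hw
  have hzx' : ‖z - x‖ < ρ := by rwa [← dist_eq_norm]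
  have hzy' : ‖z - y‖ < r := by rwa [← dist_eq_norm]
  have hwx : dist w x ≤ ρ - r / 2 := by
    have : w - x = (1 - τ) • (z - x) := by rw [hw]; module
    rw [dist_eq_norm, this, norm_smul, Real.norm_of_nonneg (by linarith)]
    nlinarith
  have hwz : dist w z ≤ r / 2 := by
    have : w - z = (-τ) • (z - x) := by rw [hw]; module
    rw [dist_eq_norm, this, norm_smul, norm_neg, Real.norm_of_nonneg hτ0]
    nlinarith
  rw [← volume_ball_nnreal w]
  refine measure_mono (subset_inter ?_ ?_)
  · refine ball_subset_closedBall.trans (closedBall_subset_closedBall' ?_)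
    push_cast
    linarith
  · refine ball_subset_ball' ?_
    have := dist_triangle w z y
    rw [dist_eq_norm z y] at this
    push_cast
    linarith

/-- Growth conditions on `f` and `g` at the scale `r₀`, in exponents `l` and `m`. -/
structure IsScalePair (f g : ℝ≥0 → ℝ≥0) (l m : ℕ) (r₀ : ℝ≥0) : Prop where
  mono : Monotone g
  mul_eq : ∀ r, r ^ l * g r = f r
  anti : ∀ r a, 0 < r → r ≤ a → r ^ (l + m) * f a ≤ a ^ (l + m) * f r
  pow_le : ∀ r, r ≤ r₀ → r ^ (l + m) ≤ f r

/-- Bounds the redistributed mass of `ball y r` coming from one `D` by `f r / r ^ (l + m)` times the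
volume of `D ∩ ball y (3 * r)`; this form can be summed over disjoint `D`. Divisions are cleared. -/
theorem volume_slab_inter_ball_mul_le [Nontrivial E] {f g : ℝ≥0 → ℝ≥0} {l m : ℕ} {r₀ : ℝ≥0}
    (hfg : IsScalePair f g l m r₀) (P : AffineSubspace ℝ E) (hl : finrank ℝ P.direction = l)
    (hm : finrank ℝ P.directionᗮ = m) {x : E} {a b : ℝ≥0} (ha : 0 < a) (hab : a ≤ b)
    (hb : b ^ m = g a) (hx : x ∈ thickening b (P : Set E)) {μ : Measure E} {C : ℝ≥0}
    (hμ : μ ≤ C • volume) (y : E) {r : ℝ≥0} (hr : 0 < r) (hr₀ : r ≤ r₀) :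
    μ (closedBall x (2 * b : ℝ≥0)) *
        volume (ball y r ∩ (ball x (2 * b : ℝ≥0) ∩ thickening (a / 2 : ℝ≥0) (P : Set E))) *
        (r : ℝ≥0∞) ^ (l + m) ≤
      (2 : ℝ≥0) ^ (4 * (l + m)) * C * f r *
        volume (closedBall x (2 * b : ℝ≥0) ∩ ball y (3 * r : ℝ≥0)) *
        volume (ball x (2 * b : ℝ≥0) ∩ thickening (a / 2 : ℝ≥0) (P : Set E)) := by
  set D := closedBall x (2 * b : ℝ≥0)
  set G := ball x (2 * b : ℝ≥0) ∩ thickening (a / 2 : ℝ≥0) (P : Set E)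
  set ω := volume (ball (0 : E) 1)
  have hd : finrank ℝ E = l + m := by
    rw [← hl, ← hm, Submodule.finrank_add_finrank_orthogonal]
  have hμ' : ∀ s, μ s ≤ C * volume s := fun s => by simpa using hμ s
  rcases (ball y r ∩ G).eq_empty_or_nonempty with he | ⟨z, hzy, hzx, -⟩
  · simp [he]
  -- If `r ≥ 2 * b`, the tripled ball contains all of `D`, and `r ^ (l + m) ≤ f r` suffices.
  rcases le_or_gt (2 * b) r with hbr | hbr
  · have hD : D ∩ ball y (3 * r : ℝ≥0) = D := by
      refine inter_eq_left.2 (closedBall_subset_ball' ?_)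
      have h1 := dist_triangle x z y
      rw [dist_comm x z] at h1
      have h2 : dist z x < (2 * b : ℝ≥0) := hzx
      have h3 : dist z y < r := hzy
      have h4 : ((2 * b : ℝ≥0) : ℝ) ≤ r := hbr
      push_cast at *
      linarith
    rw [hD]
    calc μ D * volume (ball y r ∩ G) * (r : ℝ≥0∞) ^ (l + m)
        ≤ (C * volume D) * volume G * f r := by
          gcongr
          · exact hμ' _
          · exact inter_subset_right
          · exact_mod_cast hfg.pow_le r hr₀
      _ = 1 * C * f r * volume D * volume G := by ring
      _ ≤ _ := by
          gcongr
          exact_mod_cast one_le_pow₀ (M₀ := ℝ≥0) one_le_two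
  · have hb0 : 0 < b := ha.trans_le hab
    have hlow := le_volume_ball_two_mul_inter_thickening P ha hab hx
    have hlow' := le_volume_closedBall_inter_ball hr hbr.le hzx hzy
    rw [hl, hm, hd] at hlow
    rw [hd] at hlow'
    -- `X` is an upper bound for the slab's share of `ball y r`, in units of the unit ball; the
    -- problem becomes an inequality between numbers.
    have main : ∀ X : ℝ≥0, volume (ball y r ∩ G) ≤ X * ω →
        (2 * b) ^ (l + m) * X * r ^ (l + m) ≤ 2 ^ (4 * (l + m)) * f r * (r / 2) ^ (l + m) *
          (b ^ l * (a / 2) ^ m * 2⁻¹ ^ (l + m)) →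
        μ D * volume (ball y r ∩ G) * (r : ℝ≥0∞) ^ (l + m) ≤
          (2 : ℝ≥0) ^ (4 * (l + m)) * C * f r * volume (D ∩ ball y (3 * r : ℝ≥0)) * volume G := by
      intro X hX hle
      calc μ D * volume (ball y r ∩ G) * (r : ℝ≥0∞) ^ (l + m)
          ≤ (C * (((2 * b : ℝ≥0) : ℝ≥0∞) ^ (l + m) * ω)) * (X * ω) * (r : ℝ≥0∞) ^ (l + m) := by
            gcongr
            refine (hμ' D).trans ?_
            rw [volume_closedBall_nnreal, hd]
        _ = C * ω * ω * (((2 * b) ^ (l + m) * X * r ^ (l + m) : ℝ≥0) : ℝ≥0∞) := by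
            push_cast; ring
        _ ≤ C * ω * ω * ((2 ^ (4 * (l + m)) * f r * (r / 2) ^ (l + m) *
              (b ^ l * (a / 2) ^ m * 2⁻¹ ^ (l + m)) : ℝ≥0) : ℝ≥0∞) := by
            gcongr
        _ = (2 : ℝ≥0) ^ (4 * (l + m)) * C * f r * (((r / 2 : ℝ≥0) : ℝ≥0∞) ^ (l + m) * ω) *
              ((b : ℝ≥0∞) ^ l * ((a / 2 : ℝ≥0) : ℝ≥0∞) ^ m *
                (((2⁻¹ : ℝ≥0) : ℝ≥0∞) ^ (l + m) * ω)) := by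
            simp only [ENNReal.coe_mul, ENNReal.coe_pow]; ring
        _ ≤ _ := by gcongr
    have h16 : (2 : ℝ≥0) ^ (4 * (l + m)) = 2 ^ (l + m) * 2 ^ (l + m) * 2 ^ (l + m) * 2 ^ (l + m) := by
      ring
    have h2 : (2 : ℝ≥0) ^ (l + m) ≠ 0 := by positivity
    have h2m : (2 : ℝ≥0) ^ m ≤ 2 ^ (l + m) := pow_le_pow_right₀ one_le_two (Nat.le_add_left _ _)
    -- For `a ≤ r` the slab is thin at scale `r`, and `b ^ m = g a ≤ g r`. For `r < a` the whole
    -- ball is counted and the decay of `f r / r ^ (l + m)` is used.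
    rcases le_or_gt a r with har | har
    · refine main (r ^ l * (a / 2) ^ m * 2 ^ (l + m)) ?_ ?_
      · have := volume_ball_inter_thickening_le P y hr (half_pos ha)
        rw [hl, hm, hd] at this
        refine (measure_mono (inter_subset_inter_right _ inter_subset_right)).trans
          (this.trans_eq ?_)
        push_cast
        ring
      · have hg := hfg.mono har
        calc (2 * b) ^ (l + m) * (r ^ l * (a / 2) ^ m * 2 ^ (l + m)) * r ^ (l + m)
            = 2 ^ (l + m) * 2 ^ (l + m) * b ^ l * (r ^ l * g a) * (a / 2) ^ m * r ^ (l + m) := by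
              rw [← hb]; ring
          _ ≤ 2 ^ (l + m) * 2 ^ (l + m) * b ^ l * (r ^ l * g r) * (a / 2) ^ m * r ^ (l + m) := by
              gcongr
          _ = _ := by
              rw [hfg.mul_eq, h16, div_pow r, inv_pow]
              field_simp
    · refine main (r ^ (l + m)) ?_ ?_
      · rw [ENNReal.coe_pow, ← hd, ← volume_ball_nnreal y]
        exact measure_mono inter_subset_left
      · have hf := hfg.anti r a hr har.le
        rw [← hfg.mul_eq a] at hf
        have hf' : r ^ (l + m) * g a ≤ a ^ m * f r := by
          have hal : 0 < a ^ l := by positivity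
          refine le_of_mul_le_mul_left ?_ hal
          calc a ^ l * (r ^ (l + m) * g a) = r ^ (l + m) * (a ^ l * g a) := by ring
            _ ≤ a ^ (l + m) * f r := hf
            _ = _ := by ring
        calc (2 * b) ^ (l + m) * r ^ (l + m) * r ^ (l + m)
            = 2 ^ (l + m) * b ^ l * (r ^ (l + m) * g a) * r ^ (l + m) := by
              rw [← hb]; ring
          _ ≤ 2 ^ (l + m) * b ^ l * (a ^ m * f r) * r ^ (l + m) := by gcongr
          _ = 2 ^ (l + m) * 2 ^ m * b ^ l * ((a / 2) ^ m * f r) * r ^ (l + m) := by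
              rw [div_pow]; field_simp
          _ ≤ 2 ^ (l + m) * 2 ^ (l + m) * b ^ l * ((a / 2) ^ m * f r) * r ^ (l + m) := by gcongr
          _ = _ := by
              rw [h16, div_pow r, inv_pow]
              field_simp

/-- `ν` arises from `μ` by moving mass over distances less than `δ` onto the open set `U'`, so that
small balls get `ν`-mass at most `c * f`. -/
structure IsRedistribution (f : ℝ≥0 → ℝ≥0) (c r₀ δ : ℝ≥0) (μ ν : Measure E) (U' : Set E) :
    Prop where
  bounded : ∃ C : ℝ≥0, ν ≤ C • volume
  isOpen : IsOpen U'
  null : ν U'ᶜ = 0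
  ball_le : ∀ (y : E) (r : ℝ≥0), ν (ball y r) ≤ μ (ball y (r + δ : ℝ≥0))
  ball_le' : ∀ (y : E) (r : ℝ≥0), 0 < r → r ≤ r₀ → ν (ball y r) ≤ (c * f r : ℝ≥0)

theorem sum_measure_inter_le {X ι : Type*} [MeasurableSpace X] (μ : Measure X) (F : Finset ι)
    {D : ι → Set X} (hd : (F : Set ι).PairwiseDisjoint D) (hm : ∀ i ∈ F, MeasurableSet (D i))
    {T : Set X} (hT : MeasurableSet T) :
    ∑ i ∈ F, μ (D i ∩ T) ≤ μ T := by
  rw [← measure_biUnion_finset (hd.mono fun i => inter_subset_left) fun i hi => (hm i hi).inter hT]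
  exact measure_mono (iUnion₂_subset fun i _ => inter_subset_right)

/-- Almost every point of `U` has arbitrarily small admissible radii `2 * b α`, so a Besicovitch
covering supplies the disjoint balls. Finitely many of them keep mass `M`, which makes the closure
of the union of slabs controllable. -/
theorem exists_isRedistribution [Nontrivial E] {f g : ℝ≥0 → ℝ≥0} {l m : ℕ} {r₀ : ℝ≥0}
    (hfg : IsScalePair f g l m r₀) {J : Type*} (R : J → AffineSubspace ℝ E)
    (hl : ∀ α, finrank ℝ (R α).direction = l) (hm : ∀ α, finrank ℝ (R α).directionᗮ = m)
    {a b : J → ℝ≥0} (hb : ∀ α, b α ^ m = g (a α)) (hab : {α | ¬ a α ≤ b α}.Finite)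
    (hpos : ∀ α, 0 < b α → 0 < a α) (hb0 : ∀ ε, 0 < ε → {α | ε < b α}.Finite)
    {U : Set E} (hU : IsOpen U)
    (hUb : ∀ᵐ x, x ∈ U → x ∈ limsupSet (fun α => (R α : Set E)) b) {S : Set J} (hS : S.Finite)
    {μ : Measure E} [IsFiniteMeasure μ] {C : ℝ≥0} (hμ : μ ≤ C • volume) (hμU : μ Uᶜ = 0)
    {δ : ℝ≥0} (hδ : 0 < δ) {M : ℝ≥0∞} (hM : M < μ univ) :
    ∃ (ν : Measure E) (U' : Set E),
      IsRedistribution f (2 ^ (4 * (l + m)) * 3 ^ (l + m) * (volume (ball (0 : E) 1)).toNNReal * C)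
        r₀ δ μ ν U' ∧
      closure U' ⊆ U ∩ ⋃ α ∈ Sᶜ, thickening (a α) (R α : Set E) ∧ M ≤ ν univ := by
  have hac : μ ≪ volume := (Measure.absolutelyContinuous_of_le hμ).trans
    (Measure.smul_absolutelyContinuous)
  set L : Set E := U ∩ limsupSet (fun α => (R α : Set E)) b with hL
  have hμL : μ Lᶜ = 0 := by
    have h1 : ∀ᵐ x ∂μ, x ∈ U → x ∈ limsupSet (fun α => (R α : Set E)) b := hac.ae_le hUb
    have h2 : ∀ᵐ x ∂μ, x ∈ U := hμU
    have : ∀ᵐ x ∂μ, x ∈ L := by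
      filter_upwards [h1, h2] with x hx hx'
      exact ⟨hx', hx hx'⟩
    exact this
  let φ : E → Set ℝ := fun x => {ρ | ∃ α, α ∉ S ∧ a α ≤ b α ∧ 0 < b α ∧
    x ∈ thickening (b α) (R α : Set E) ∧ ρ = (2 * b α : ℝ≥0)}
  have hφ : ∀ x ∈ L, ∀ ε > 0, (φ x ∩ Ioo 0 ε).Nonempty := by
    intro x hx ε hε
    have hfin : (S ∪ {α | ¬ a α ≤ b α} ∪ {α | (ε / 4).toNNReal < b α}).Finite :=
      (hS.union hab).union (hb0 _ (Real.toNNReal_pos.2 (by positivity)))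
    obtain ⟨α, hα, hα'⟩ := (hx.2.sdiff hfin).nonempty
    simp only [mem_union, mem_ofPred_eq, not_or, not_not, not_lt] at hα'
    have hbα : 0 < b α := by
      have := thickening_nonempty_iff.1 ⟨x, hα⟩
      exact_mod_cast this.1
    refine ⟨_, ⟨α, hα'.1.1, hα'.1.2, hbα, hα, rfl⟩, by positivity, ?_⟩
    have := (Real.le_toNNReal_iff_coe_le (by positivity)).1 hα'.2
    push_cast
    linarith
  have hrad : ∀ x : E, ∃ ρ : ℝ, 0 < ρ ∧ (x ∈ L → ball x ρ ⊆ U) := by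
    intro x
    by_cases hx : x ∈ L
    · obtain ⟨ρ, hρ, h⟩ := Metric.isOpen_iff.1 hU x hx.1
      exact ⟨ρ, hρ, fun _ => h⟩
    · exact ⟨1, one_pos, fun h => absurd h hx⟩
  choose Q hQ hQU using hrad
  have hδ' : (0 : ℝ) < δ := hδ
  obtain ⟨t, r, htc, htL, hrt, hcov, hdisj⟩ := Besicovitch.exists_disjoint_closedBall_covering_ae
    μ φ L hφ (fun x => min (Q x) (δ / 2)) (fun x _ => lt_min (hQ x) (by positivity))
  have hα : ∀ x : t, ∃ α, α ∉ S ∧ a α ≤ b α ∧ 0 < b α ∧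
      (x : E) ∈ thickening (b α) (R α : Set E) ∧ r x = (2 * b α : ℝ≥0) := fun x => (hrt x x.2).1
  choose α hαS hαab hαb hαx hαr using hα
  have : Countable t := htc.to_subtype
  set D : t → Set E := fun x => closedBall (x : E) (2 * b (α x) : ℝ≥0) with hD
  set G : t → Set E := fun x =>
    ball (x : E) (2 * b (α x) : ℝ≥0) ∩ thickening (a (α x) / 2 : ℝ≥0) (R (α x) : Set E) with hG
  have hDr : ∀ x : t, closedBall (x : E) (r x) = D x := fun x => by rw [hαr]
  have hGo : ∀ x, IsOpen (G x) := fun x => isOpen_ball.inter isOpen_thickening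
  have hGt : ∀ x, volume (G x) ≠ ∞ := fun x =>
    ((measure_mono inter_subset_left).trans_lt measure_ball_lt_top).ne
  have ha : ∀ x, 0 < a (α x) := fun x => hpos _ (hαb x)
  have hG0 : ∀ x, volume (G x) ≠ 0 := by
    intro x
    refine (lt_of_lt_of_le ?_
      (le_volume_ball_two_mul_inter_thickening (R (α x)) (ha x) (hαab x) (hαx x))).ne'
    have h1 := ha x
    have h2 := hαb x
    have h3 := measure_ball_pos (volume : Measure E) 0 one_pos
    positivity
  have hDdisj : Pairwise (Function.onFun Disjoint D) := by
    intro x x' hxx'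
    have := hdisj x.2 x'.2 (fun h => hxx' (Subtype.ext h))
    simpa only [Function.onFun, hDr] using this
  have hDm : ∀ x, MeasurableSet (D x) := fun x => isClosed_closedBall.measurableSet
  have hDδ : ∀ x, (2 * (2 * b (α x) : ℝ≥0) : ℝ) < δ := by
    intro x
    have := ((hrt x x.2).2.2).trans_le (min_le_right _ _)
    rw [hαr] at this
    linarith
  have hDU : ∀ x, D x ⊆ U := by
    intro x
    have := ((hrt x x.2).2.2).trans_le (min_le_left _ _)
    rw [hαr] at this
    exact (closedBall_subset_ball this).trans (hQU x (htL x.2))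
  -- a finite subfamily carries almost all the mass
  have htot : μ univ ≤ ∑' x, μ (D x) := by
    have h1 : μ (⋃ x, D x)ᶜ = 0 := by
      refine measure_mono_null (t := Lᶜ ∪ (L \ ⋃ x ∈ t, closedBall x (r x))) ?_
        (measure_union_null hμL hcov)
      intro y hy
      by_cases hyL : y ∈ L
      · refine Or.inr ⟨hyL, fun h => hy ?_⟩
        obtain ⟨x, hx, hxy⟩ := mem_iUnion₂.1 h
        exact mem_iUnion.2 ⟨⟨x, hx⟩, by rwa [← hDr]⟩
      · exact Or.inl hyL
    calc μ univ ≤ μ (⋃ x, D x) + μ (⋃ x, D x)ᶜ := by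
          rw [← union_compl_self (⋃ x, D x)]; exact measure_union_le _ _
      _ = μ (⋃ x, D x) := by rw [h1, add_zero]
      _ ≤ _ := measure_iUnion_le _
  have hM' := hM.trans_le htot
  rw [ENNReal.tsum_eq_iSup_sum, lt_iSup_iff] at hM'
  obtain ⟨F, hF⟩ := hM'
  set ν : Measure E := ∑ x ∈ F, (μ (D x) / volume (G x)) • volume.restrict (G x) with hν
  have hνapp : ∀ s, MeasurableSet s →
      ν s = ∑ x ∈ F, μ (D x) / volume (G x) * volume (s ∩ G x) := by
    intro s hs
    simp [hν, Measure.finsetSum_apply, Measure.restrict_apply hs]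
  -- Half-width `a / 2` in `G` leaves room for the closure inside the open `a`-neighbourhood.
  have hcl : closure (⋃ x ∈ F, G x) ⊆ ⋃ x ∈ F, (D x ∩ thickening (a (α x)) (R (α x) : Set E)) := by
    rw [F.closure_biUnion]
    refine iUnion₂_mono fun x _ => ?_
    refine (closure_inter_subset_inter_closure _ _).trans (inter_subset_inter ?_ ?_)
    · exact closure_ball_subset_closedBall
    · refine (closure_thickening_subset_cthickening _ _).trans
        (cthickening_subset_thickening' ?_ ?_ _)
      · exact_mod_cast ha x
      · exact_mod_cast NNReal.half_lt_self (ha x).ne'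
  refine ⟨ν, ⋃ x ∈ F, G x, ⟨?_, ?_, ?_, ?_, ?_⟩, ?_, ?_⟩
  · refine ⟨∑ x ∈ F, (μ (D x) / volume (G x)).toNNReal, ?_⟩
    rw [hν, Finset.sum_smul]
    refine Finset.sum_le_sum fun x _ => ?_
    have : μ (D x) / volume (G x) ≠ ∞ := ENNReal.div_ne_top (measure_ne_top _ _) (hG0 x)
    rw [← ENNReal.coe_toNNReal this]
    intro s
    simp only [Measure.smul_apply, ENNReal.smul_def, smul_eq_mul, ENNReal.toNNReal_coe]
    gcongr
    exact Measure.restrict_le_self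
  · exact isOpen_biUnion fun x _ => hGo x
  · have hop : IsOpen (⋃ x ∈ F, G x) := isOpen_biUnion fun x _ => hGo x
    rw [hνapp _ hop.measurableSet.compl]
    refine Finset.sum_eq_zero fun x hx => ?_
    have : (⋃ x ∈ F, G x)ᶜ ∩ G x = ∅ := by
      rw [← disjoint_iff_inter_eq_empty, disjoint_compl_left_iff_subset]
      exact subset_biUnion_of_mem (u := G) hx
    rw [this, measure_empty, mul_zero]
  · intro y r'
    rw [hνapp _ isOpen_ball.measurableSet]
    refine le_trans (Finset.sum_le_sum fun x _ => ?_)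
      (sum_measure_inter_le μ F (D := D) (hDdisj.set_pairwise _) (fun x _ => hDm x)
        isOpen_ball.measurableSet)
    rcases (ball y r' ∩ G x).eq_empty_or_nonempty with he | ⟨z, hzy, hzx, -⟩
    · simp [he]
    have hsub : D x ⊆ ball y (r' + δ : ℝ≥0) := by
      refine closedBall_subset_ball' ?_
      have h1 := dist_triangle (x : E) z y
      rw [dist_comm _ z] at h1
      have h2 : dist z x < (2 * b (α x) : ℝ≥0) := hzx
      have h3 : dist z y < r' := hzy
      have h4 := hDδ x
      push_cast at *
      linarith
    rw [inter_eq_left.2 hsub]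
    calc μ (D x) / volume (G x) * volume (ball y r' ∩ G x)
        ≤ μ (D x) / volume (G x) * volume (G x) := by gcongr; exact inter_subset_right
      _ = μ (D x) := ENNReal.div_mul_cancel (hG0 x) (hGt x)
  · intro y r' hr' hr'₀
    rw [hνapp _ isOpen_ball.measurableSet]
    -- The dimension is read off from one of the planes, so an empty family is treated separately.
    have hd : finrank ℝ E = l + m ∨ F = ∅ := by
      rcases F.eq_empty_or_nonempty with h | ⟨x, -⟩
      · exact Or.inr h
      · left
        rw [← hl (α x), ← hm (α x), Submodule.finrank_add_finrank_orthogonal]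
    rcases hd with hd | hd
    swap
    · simp [hd]
    have hr0 : (r' : ℝ≥0∞) ^ (l + m) ≠ 0 := by positivity
    have hrt : (r' : ℝ≥0∞) ^ (l + m) ≠ ∞ := by finiteness
    set K : ℝ≥0∞ := (2 : ℝ≥0) ^ (4 * (l + m)) * C * f r' / (r' : ℝ≥0∞) ^ (l + m) with hK
    calc ∑ x ∈ F, μ (D x) / volume (G x) * volume (ball y r' ∩ G x)
        ≤ ∑ x ∈ F, K * volume (D x ∩ ball y (3 * r' : ℝ≥0)) := by
          refine Finset.sum_le_sum fun x _ => ?_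
          have h1 := volume_slab_inter_ball_mul_le hfg (R (α x)) (hl _) (hm _) (ha x) (hαab x)
            (hb _) (hαx x) hμ y hr' hr'₀
          rw [hK, ← ENNReal.mul_div_right_comm, ← ENNReal.mul_div_right_comm,
            ENNReal.div_le_iff (hG0 x) (hGt x), ← ENNReal.mul_div_right_comm,
            ENNReal.le_div_iff_mul_le (Or.inl hr0) (Or.inl hrt)]
          exact h1
      _ = K * ∑ x ∈ F, volume (D x ∩ ball y (3 * r' : ℝ≥0)) := by rw [Finset.mul_sum]
      _ ≤ K * volume (ball y (3 * r' : ℝ≥0)) := by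
          gcongr
          exact sum_measure_inter_le volume F (D := D) (hDdisj.set_pairwise _) (fun x _ => hDm x)
            isOpen_ball.measurableSet
      _ = _ := by
          have hω := ENNReal.coe_toNNReal (volume_unitBall_ne_top (E := E))
          rw [volume_ball_nnreal, hd, hK, ← hω, ENNReal.coe_mul 3, mul_pow,
            ← ENNReal.mul_div_right_comm, ENNReal.toNNReal_coe]
          set ω := (volume (ball (0 : E) 1)).toNNReal
          rw [show ((2 : ℝ≥0) : ℝ≥0∞) ^ (4 * (l + m)) * C * f r' *
              (((3 : ℝ≥0) : ℝ≥0∞) ^ (l + m) * (r' : ℝ≥0∞) ^ (l + m) * (ω : ℝ≥0∞)) =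
              ((2 ^ (4 * (l + m)) * 3 ^ (l + m) * ω * C * f r' : ℝ≥0) : ℝ≥0∞) *
                (r' : ℝ≥0∞) ^ (l + m) by
            simp only [ENNReal.coe_mul, ENNReal.coe_pow]; ring,
            ENNReal.mul_div_cancel_right hr0 hrt]
  · refine hcl.trans (iUnion₂_subset fun x _ => inter_subset_inter (hDU x) ?_)
    exact subset_biUnion_of_mem (u := fun α => thickening (a α) (R α : Set E)) (hαS x)
  · refine hF.le.trans_eq ?_
    rw [hνapp _ MeasurableSet.univ]
    refine Finset.sum_congr rfl fun x _ => ?_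
    rw [univ_inter, ENNReal.div_mul_cancel (hG0 x) (hGt x)]

end Redistribution

/-! ### Averaging over scales -/

section Iteration

variable {E : Type*} [NormedAddCommGroup E] [InnerProductSpace ℝ E] [FiniteDimensional ℝ E]
  [MeasurableSpace E] [BorelSpace E]

theorem isFiniteMeasure_of_le_smul_volume {μ : Measure E} {C : ℝ≥0} (hμ : μ ≤ C • volume)
    {U : Set E} (hU : Bornology.IsBounded U) (hμU : μ Uᶜ = 0) : IsFiniteMeasure μ := by
  refine ⟨?_⟩
  calc μ univ ≤ μ U + μ Uᶜ := by
        rw [← union_compl_self U]; exact measure_union_le _ _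
    _ = μ U := by rw [hμU, add_zero]
    _ ≤ C * volume U := by simpa using hμ U
    _ < ∞ := ENNReal.mul_lt_top ENNReal.coe_lt_top hU.measure_lt_top

/-- Uniform continuity on `[0, ρ]` makes the increment of `f` small relative to `f s ≤ f r`. The `+
1` in the tolerance covers `M₀ = 0`. -/
theorem exists_forall_mul_shift_le {f : ℝ≥0 → ℝ≥0} (hf : Continuous f) (hfm : Monotone f)
    {s ρ ρ' M₀ M₁ : ℝ≥0} (hs : 0 < f s) (hρ : ρ' < ρ) (hM : M₀ < M₁) :
    ∃ δ, 0 < δ ∧ ∀ r, s ≤ r → r ≤ ρ' → r + δ ≤ ρ ∧ M₀ * f (r + δ) ≤ M₁ * f r := by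
  have hu := (isCompact_Icc (a := (0 : ℝ≥0)) (b := ρ)).uniformContinuousOn_of_continuous
    hf.continuousOn
  have hM' : (0 : ℝ) < M₁ - M₀ := sub_pos.2 hM
  have hs' : (0 : ℝ) < f s := hs
  have hM₀ : (0 : ℝ) ≤ M₀ := M₀.coe_nonneg
  obtain ⟨δ, hδ, h⟩ := Metric.uniformContinuousOn_iff.1 hu ((M₁ - M₀) * f s / (M₀ + 1))
    (by positivity)
  set τ : ℝ≥0 := min (ρ - ρ') (δ / 2).toNNReal with hτ
  have hτ0 : 0 < τ := lt_min (tsub_pos_of_lt hρ) (Real.toNNReal_pos.2 (by positivity))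
  have hτδ : (τ : ℝ) < δ := by
    have : (τ : ℝ) ≤ δ / 2 := (Real.le_toNNReal_iff_coe_le (by positivity)).1 (min_le_right _ _)
    linarith
  refine ⟨τ, hτ0, fun r hsr hr => ?_⟩
  have hrτ : r + τ ≤ ρ := by
    calc r + τ ≤ ρ' + (ρ - ρ') := add_le_add hr (min_le_left _ _)
      _ = ρ := add_tsub_cancel_of_le hρ.le
  refine ⟨hrτ, ?_⟩
  have h1 := h (r + τ) ⟨zero_le, hrτ⟩ r ⟨zero_le, hr.trans hρ.le⟩ (by
    rw [NNReal.dist_eq]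
    push_cast
    rw [add_sub_cancel_left, abs_of_nonneg τ.coe_nonneg]
    exact hτδ)
  rw [NNReal.dist_eq] at h1
  have h2 := (le_abs_self _).trans h1.le
  rw [le_div_iff₀ (by positivity)] at h2
  have h3 : (f s : ℝ) ≤ f r := hfm hsr
  have h4 : (f r : ℝ) ≤ f (r + τ) := hfm le_self_add
  rw [← NNReal.coe_le_coe]
  push_cast
  nlinarith

theorem exists_forall_mul_pow_le {f : ℝ≥0 → ℝ≥0} {d : ℕ}
    (hbig : ∀ K : ℝ≥0, ∃ s, 0 < s ∧ ∀ r, 0 < r → r ≤ s → K * r ^ d ≤ f r) {M s₀ : ℝ≥0} (hM : 0 < M)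
    (hs₀ : 0 < s₀) (K : ℝ≥0) :
    ∃ s, 0 < s ∧ s ≤ s₀ ∧ ∀ r, 0 < r → r ≤ s → K * r ^ d ≤ M * f r := by
  obtain ⟨s, hs, h⟩ := hbig (K / M)
  refine ⟨min s s₀, lt_min hs hs₀, min_le_right _ _, fun r hr hrs => ?_⟩
  have := mul_le_mul_right (h r hr (hrs.trans (min_le_left _ _))) M
  calc K * r ^ d = M * (K / M * r ^ d) := by field_simp
    _ ≤ M * f r := this

variable [Nontrivial E]

/-- Averaging redistributions of `μ` at sufficiently many, rapidly decreasing scales. -/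
theorem exists_averaged_redistribution {f : ℝ≥0 → ℝ≥0} (hf : Continuous f) (hfm : Monotone f)
    (hfpos : ∀ r, 0 < r → 0 < f r)
    (hbig : ∀ K : ℝ≥0, ∃ s, 0 < s ∧ ∀ r, 0 < r → r ≤ s → K * r ^ finrank ℝ E ≤ f r)
    {c r₀ : ℝ≥0} (hr₀ : 0 < r₀) {A U : Set E} {μ : Measure E} {C : ℝ≥0} (hμ : μ ≤ C • volume)
    {M : ℝ≥0∞}
    (hred : ∀ δ, 0 < δ → ∃ (ν : Measure E) (U' : Set E), IsRedistribution f c r₀ δ μ ν U' ∧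
      closure U' ⊆ U ∩ A ∧ M ≤ ν univ)
    {M₀ M₁ ρ ρ' : ℝ≥0} (hM : M₀ < M₁) (hρ : ρ' < ρ)
    (hb : ∀ (y : E) (r : ℝ≥0), 0 < r → r ≤ ρ → μ (ball y r) ≤ (M₀ * f r : ℝ≥0)) :
    ∃ (ν : Measure E) (U' : Set E), (∃ C : ℝ≥0, ν ≤ C • volume) ∧ IsOpen U' ∧ ν U'ᶜ = 0 ∧
      closure U' ⊆ U ∩ A ∧ M ≤ ν univ ∧
      ∀ (y : E) (r : ℝ≥0), 0 < r → r ≤ ρ' → ν (ball y r) ≤ (M₁ * f r : ℝ≥0) := by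
  set d := finrank ℝ E with hd
  set ω : ℝ≥0 := (volume (ball (0 : E) 1)).toNNReal with hω
  have hω' : (ω : ℝ≥0∞) = volume (ball (0 : E) 1) := ENNReal.coe_toNNReal volume_unitBall_ne_top
  have hM₁ : 0 < M₁ := zero_le.trans_lt hM
  have hvol : ∀ {μ : Measure E} {C : ℝ≥0}, μ ≤ C • volume → ∀ (y : E) (r : ℝ≥0),
      μ (ball y r) ≤ (C * ω * r ^ d : ℝ≥0) := by
    intro μ C hμ y r
    calc μ (ball y r) ≤ C * volume (ball y r) := by simpa using hμ (ball y r)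
      _ = _ := by rw [volume_ball_nnreal, ← hω']; push_cast; ring
  obtain ⟨s₀, hs₀, hs₀r, hs₀f⟩ := exists_forall_mul_pow_le hbig (half_pos hM₁) hr₀ (C * ω * 2 ^ d)
  obtain ⟨δ₁, hδ₁, hδ₁f⟩ := exists_forall_mul_shift_le hf hfm (hfpos s₀ hs₀) hρ hM
  -- Sums of `T` redistributions. Below `s₀`, each contributes at most `M₁ / 2`, except one at its
  -- bad scale, which costs `c` once and for all.
  have key : ∀ T : ℕ, ∃ (σ : Measure E) (U' : Set E), (∃ C : ℝ≥0, σ ≤ C • volume) ∧ IsOpen U' ∧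
      σ U'ᶜ = 0 ∧ closure U' ⊆ U ∩ A ∧ T * M ≤ σ univ ∧
      (∀ (y : E) (r : ℝ≥0), s₀ ≤ r → r ≤ ρ' → σ (ball y r) ≤ (T * M₁ * f r : ℝ≥0)) ∧
      ∀ (y : E) (r : ℝ≥0), 0 < r → r ≤ s₀ → σ (ball y r) ≤ ((T * (M₁ / 2) + c) * f r : ℝ≥0) := by
    intro T
    induction T with
    | zero => exact ⟨0, ∅, ⟨0, by simp⟩, isOpen_empty, by simp, by simp, by simp, by simp, by simp⟩
    | succ T ih =>
      obtain ⟨σ, U', ⟨C', hσC⟩, hUo, hσU, hcl, hmass, hlarge, hsmall⟩ := ih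
      -- Below `s` the bounded density of the previous sum makes it negligible against `f`; the new
      -- measure moves mass by less than `s`, so above `s` it is compared with `μ` on the doubled
      -- ball.
      obtain ⟨s, hs, hss₀, hsf⟩ := exists_forall_mul_pow_le hbig (half_pos hM₁) hs₀ (C' * ω)
      obtain ⟨ν, V, ⟨⟨C'', hνC⟩, hVo, hνV, hle, hle'⟩, hVcl, hνM⟩ :=
        hred (min δ₁ s) (lt_min hδ₁ hs)
      refine ⟨σ + ν, U' ∪ V, ⟨C' + C'', ?_⟩, hUo.union hVo, ?_, ?_, ?_, ?_, ?_⟩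
      · rw [add_smul]; exact add_le_add hσC hνC
      · rw [Measure.add_apply, compl_union]
        simp [measure_mono_null inter_subset_left hσU, measure_mono_null inter_subset_right hνV]
      · rw [closure_union]; exact union_subset hcl hVcl
      · rw [Measure.add_apply, Nat.cast_succ, add_mul, one_mul]
        exact add_le_add hmass hνM
      · intro y r hr hrρ
        have h1 := hδ₁f r hr hrρ
        have h2 : ν (ball y r) ≤ (M₁ * f r : ℝ≥0) := by
          calc ν (ball y r) ≤ μ (ball y (r + min δ₁ s : ℝ≥0)) := hle y r
            _ ≤ μ (ball y (r + δ₁ : ℝ≥0)) := by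
                gcongr
                exact min_le_left _ _
            _ ≤ (M₀ * f (r + δ₁) : ℝ≥0) := hb y _ (hδ₁.trans_le le_add_self) h1.1
            _ ≤ _ := by exact_mod_cast h1.2
        rw [Measure.add_apply]
        refine (add_le_add (hlarge y r hr hrρ) h2).trans_eq ?_
        push_cast
        ring
      · intro y r hr hrs₀
        rw [Measure.add_apply]
        rcases le_or_gt r s with hrs | hrs
        · have h1 : σ (ball y r) ≤ (M₁ / 2 * f r : ℝ≥0) :=
            (hvol hσC y r).trans (by exact_mod_cast hsf r hr hrs)
          have h2 := hle' y r hr (hrs₀.trans hs₀r)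
          refine (add_le_add h1 h2).trans ?_
          rw [← ENNReal.coe_add, ENNReal.coe_le_coe, ← add_mul]
          gcongr
          exact le_mul_of_one_le_left zero_le (by simp)
        · have h2 : ν (ball y r) ≤ (M₁ / 2 * f r : ℝ≥0) := by
            calc ν (ball y r) ≤ μ (ball y (r + min δ₁ s : ℝ≥0)) := hle y r
              _ ≤ μ (ball y (2 * r : ℝ≥0)) := by
                  gcongr
                  rw [two_mul]
                  gcongr
                  exact (min_le_right _ _).trans hrs.le
              _ ≤ (C * ω * (2 * r) ^ d : ℝ≥0) := hvol hμ _ _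
              _ = (C * ω * 2 ^ d * r ^ d : ℝ≥0) := by rw [mul_pow]; congr 1; ring
              _ ≤ _ := by exact_mod_cast hs₀f r hr hrs₀
          refine (add_le_add (hsmall y r hr hrs₀) h2).trans_eq ?_
          push_cast
          ring
  -- With this many terms the single cost `c` is absorbed by the other half of `T * M₁`.
  obtain ⟨T, hT⟩ := exists_nat_gt (c / (M₁ / 2))
  have hT0 : (0 : ℝ≥0) < T := zero_le.trans_lt hT
  have hT0' : (T : ℝ≥0∞) ≠ 0 := by exact_mod_cast hT0.ne'
  rw [div_lt_iff₀ (half_pos hM₁)] at hT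
  obtain ⟨σ, U', ⟨C', hσC⟩, hUo, hσU, hcl, hmass, hlarge, hsmall⟩ := key T
  have hscale : ∀ {x b : ℝ≥0∞}, x ≤ T * b → (T : ℝ≥0∞)⁻¹ * x ≤ b := by
    intro x b h
    calc (T : ℝ≥0∞)⁻¹ * x ≤ (T : ℝ≥0∞)⁻¹ * (T * b) := by gcongr
      _ = b := by rw [← mul_assoc, ENNReal.inv_mul_cancel hT0' (by simp), one_mul]
  refine ⟨(T : ℝ≥0∞)⁻¹ • σ, U', ⟨(T : ℝ≥0)⁻¹ * C', ?_⟩, hUo, ?_, hcl, ?_, ?_⟩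
  · intro t
    have := hσC t
    simp only [Measure.smul_apply, ENNReal.smul_def, smul_eq_mul] at this ⊢
    rw [ENNReal.coe_mul, ENNReal.coe_inv hT0.ne', mul_assoc]
    push_cast
    gcongr
  · simp [hσU]
  · rw [Measure.smul_apply, smul_eq_mul]
    calc M = (T : ℝ≥0∞)⁻¹ * (T * M) := by
          rw [← mul_assoc, ENNReal.inv_mul_cancel hT0' (by simp), one_mul]
      _ ≤ _ := by gcongr
  · intro y r hr hrρ
    rw [Measure.smul_apply, smul_eq_mul]
    refine hscale ?_
    rcases le_or_gt s₀ r with h | h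
    · refine (hlarge y r h hrρ).trans_eq ?_
      push_cast
      ring
    · refine (hsmall y r hr h.le).trans ?_
      rw [show (T : ℝ≥0∞) = ((T : ℝ≥0) : ℝ≥0∞) by simp, ← ENNReal.coe_mul, ENNReal.coe_le_coe,
        ← mul_assoc]
      gcongr
      calc T * (M₁ / 2) + c ≤ T * (M₁ / 2) + T * (M₁ / 2) := by gcongr
        _ = T * M₁ := by rw [← mul_add, add_halves]

end Iteration

/-! ### Monotonicity and subadditivity of Hausdorff measures -/

section HausdorffMono

variable {X : Type*} [PseudoMetricSpace X]

theorem hausdorffContent_mono {f : ℝ≥0 → ℝ≥0} {ρ : ℝ≥0} {F G : Set X} (h : F ⊆ G) :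
    hausdorffContent f ρ F ≤ hausdorffContent f ρ G :=
  le_iInf fun c => le_iInf fun r => le_iInf fun hr => le_iInf fun hG =>
    iInf_le_of_le c (iInf_le_of_le r (iInf_le_of_le hr (iInf_le_of_le (h.trans hG) le_rfl)))

theorem hausdorffMeas_mono {f : ℝ≥0 → ℝ≥0} {F G : Set X} (h : F ⊆ G) :
    hausdorffMeas f F ≤ hausdorffMeas f G :=
  iSup₂_mono fun _ _ => hausdorffContent_mono h

theorem hausdorffContent_union_le [Nonempty X] {f : ℝ≥0 → ℝ≥0} (h0 : f 0 = 0) {ρ : ℝ≥0}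
    (F G : Set X) :
    hausdorffContent f ρ (F ∪ G) ≤ hausdorffContent f ρ F + hausdorffContent f ρ G := by
  rw [hausdorffContent.eq_def f ρ F, hausdorffContent.eq_def f ρ G]
  simp only [ENNReal.iInf_add, ENNReal.add_iInf]
  refine le_iInf fun c' => le_iInf fun r' => le_iInf fun hr' => le_iInf fun hG => ?_
  refine le_iInf fun c => le_iInf fun r => le_iInf fun hr => le_iInf fun hF => ?_
  refine (hausdorffContent_le_tsum h0 (Sum.elim c c') (Sum.elim r r')
    (by rintro (i | i); exacts [hr i, hr' i]) ?_).trans_eq ?_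
  · rw [iUnion_sum]
    exact union_subset_union hF hG
  · rw [Summable.tsum_sum (f := fun i => (f (Sum.elim r r' i) : ℝ≥0∞)) ENNReal.summable
      ENNReal.summable]
    rfl

theorem hausdorffMeas_union_le [Nonempty X] {f : ℝ≥0 → ℝ≥0} (h0 : f 0 = 0) (F G : Set X) :
    hausdorffMeas f (F ∪ G) ≤ hausdorffMeas f F + hausdorffMeas f G :=
  iSup₂_le fun ρ hρ => (hausdorffContent_union_le h0 F G).trans
    (add_le_add (le_iSup₂_of_le ρ hρ le_rfl) (le_iSup₂_of_le ρ hρ le_rfl))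

end HausdorffMono

/-! ### Limsup sets of neighbourhoods -/

section LimsupSet

variable {X J : Type*} [PseudoMetricSpace X]

theorem limsupSet_eq_limsup (e : ℕ ≃ J) (R : J → Set X) (a : J → ℝ≥0) :
    limsupSet R a = limsup (fun n => thickening (a (e n)) (R (e n))) atTop := by
  ext x
  rw [mem_limsup_iff_frequently_mem, Nat.frequently_atTop_iff_infinite]
  change {α | x ∈ thickening (a α) (R α)}.Infinite ↔ (e ⁻¹' {α | x ∈ thickening (a α) (R α)}).Infinite
  rw [← infinite_image_iff (f := e) e.injective.injOn, image_preimage_eq _ e.surjective]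

theorem measurableSet_limsupSet [Countable J] [Infinite J] [MeasurableSpace X]
    [OpensMeasurableSpace X] (R : J → Set X) (a : J → ℝ≥0) : MeasurableSet (limsupSet R a) := by
  obtain ⟨e⟩ := nonempty_equiv_of_countable (α := ℕ) (β := J)
  rw [limsupSet_eq_limsup e]
  exact MeasurableSet.measurableSet_limsup fun n => isOpen_thickening.measurableSet

theorem limsupSet_const_mul_ae_eq [Countable J] [Infinite J] [SecondCountableTopology X]
    [MeasurableSpace X] [BorelSpace X] (μ : Measure X) [IsLocallyFiniteMeasure μ]
    [IsUnifLocDoublingMeasure μ] (R : J → Set X) {a : J → ℝ≥0}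
    (ha : ∀ ε, 0 < ε → {α | ε < a α}.Finite) {M : ℝ≥0} (hM : 0 < M) :
    limsupSet R (fun α => M * a α) =ᵐ[μ] limsupSet R a := by
  obtain ⟨e⟩ := nonempty_equiv_of_countable (α := ℕ) (β := J)
  have hlim : Tendsto (fun n => (a (e n) : ℝ)) atTop (𝓝 0) := by
    rw [← NNReal.coe_zero, NNReal.tendsto_coe, ← Nat.cofinite_eq_atTop]
    refine (nhds_bot_basis (α := ℝ≥0)).tendsto_right_iff.2 fun ε hε => ?_
    obtain ⟨ε', hε', hεε'⟩ := exists_between hε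
    refine ((ha ε' hε').preimage e.injective.injOn).subset fun n hn => ?_
    exact hεε'.trans_le (not_lt.1 hn)
  have := blimsup_thickening_mul_ae_eq μ (fun _ => True) (fun n => R (e n))
    (NNReal.coe_pos.2 hM) (fun n => (a (e n) : ℝ)) hlim
  rw [limsupSet_eq_limsup e, limsupSet_eq_limsup e]
  simpa only [blimsup_true, NNReal.coe_mul] using this

theorem limsupSet_subset_of_finite {R : J → Set X} {a b : J → ℝ≥0}
    (h : {α | ¬ a α ≤ b α}.Finite) : limsupSet R a ⊆ limsupSet R b := by
  intro x hx
  refine (hx.sdiff h).mono fun α hα => ?_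
  have h1 : a α ≤ b α := not_not.1 hα.2
  exact thickening_mono (NNReal.coe_le_coe.2 h1) _ hα.1

theorem iInter_biUnion_subset_limsupSet (e : J → ℕ) (R : J → Set X) (a : J → ℝ≥0) :
    ⋂ n, ⋃ α ∈ {α | e α < n}ᶜ, thickening (a α) (R α) ⊆ limsupSet R a := by
  intro x hx hfin
  obtain ⟨n, hn⟩ := (hfin.image e).bddAbove
  obtain ⟨α, hα, hxα⟩ := mem_iUnion₂.1 (mem_iInter.1 hx (n + 1))
  have h1 : e α ≤ n := hn (mem_image_of_mem e hxα)
  exact hα (Nat.lt_succ_of_le h1)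

end LimsupSet

/-! ### Null sets, and infinite measure by iteration -/

section FullMeasure

variable {E : Type*} [NormedAddCommGroup E] [InnerProductSpace ℝ E] [FiniteDimensional ℝ E]
  [MeasurableSpace E] [BorelSpace E] [Nontrivial E]

theorem mul_hausdorffMeas_pow_eq {F : Set E} (hF : volume F ≠ ∞) :
    volume (ball (0 : E) 1) * hausdorffMeas (fun r => r ^ finrank ℝ E) F = volume F := by
  refine le_antisymm ?_ ?_
  · simpa using hausdorffMeas_le_mul_volume (f := fun r => r ^ finrank ℝ E) (c := 1)
      (by simp [finrank_pos.ne']) one_pos (by simp) hF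
  · simpa using mul_volume_le_hausdorffMeas (f := fun r => r ^ finrank ℝ E) (c := 1) one_pos
      (by simp) F

theorem hausdorffMeas_inter_eq_of_ae {f : ℝ≥0 → ℝ≥0} (h0 : f 0 = 0) {c ρ : ℝ≥0} (hρ : 0 < ρ)
    (h : ∀ r, 0 < r → r ≤ ρ → f r ≤ c * r ^ finrank ℝ E) {B L : Set E}
    (hBL : volume (B \ L) = 0) : hausdorffMeas f (B ∩ L) = hausdorffMeas f B := by
  refine le_antisymm (hausdorffMeas_mono inter_subset_left) ?_
  have h1 := hausdorffMeas_le_mul_volume h0 hρ h (F := B \ L) (by simp [hBL])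
  rw [hBL, mul_zero, nonpos_iff_eq_zero, mul_eq_zero,
    or_iff_right volume_unitBall_ne_zero] at h1
  calc hausdorffMeas f B = hausdorffMeas f (B ∩ L ∪ B \ L) := by rw [inter_union_sdiff]
    _ ≤ _ := hausdorffMeas_union_le h0 _ _
    _ = _ := by rw [h1, add_zero]

/-- If all finite-stage redistributions are possible, the limsup set has infinite `f`-measure. -/
theorem hausdorffMeas_inter_iInter_eq_top {f : ℝ≥0 → ℝ≥0} (hf : Continuous f) (hfm : Monotone f)
    (hfpos : ∀ r, 0 < r → 0 < f r)
    (hbig : ∀ K : ℝ≥0, ∃ s, 0 < s ∧ ∀ r, 0 < r → r ≤ s → K * r ^ finrank ℝ E ≤ f r)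
    {c r₀ : ℝ≥0} (hr₀ : 0 < r₀) {O : Set E} (hO : IsOpen O) (hOb : Bornology.IsBounded O)
    (hOn : O.Nonempty) {A : ℕ → Set E}
    (hred : ∀ n (μ : Measure E) [IsFiniteMeasure μ] (C : ℝ≥0) (U : Set E), IsOpen U → U ⊆ O →
      μ ≤ C • volume → μ Uᶜ = 0 → ∀ M < μ univ, ∀ δ, 0 < δ → ∃ (ν : Measure E) (U' : Set E),
      IsRedistribution f (c * C) r₀ δ μ ν U' ∧ closure U' ⊆ U ∩ A n ∧ M ≤ ν univ) :
    hausdorffMeas f (O ∩ ⋂ n, A n) = ∞ := by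
  set V := volume O with hV
  have hV0 : V ≠ 0 := (hO.measure_pos volume hOn).ne'
  have hVt : V ≠ ∞ := hOb.measure_lt_top.ne
  set ω : ℝ≥0 := (volume (ball (0 : E) 1)).toNNReal with hω
  have hω' : (ω : ℝ≥0∞) = volume (ball (0 : E) 1) := ENNReal.coe_toNNReal volume_unitBall_ne_top
  have key : ∀ η : ℝ≥0, 0 < η → V / 2 ≤ η * hausdorffMeas f (O ∩ ⋂ n, A n) := by
    intro η hη
    obtain ⟨s, hs, -, hsf⟩ := exists_forall_mul_pow_le hbig (half_pos hη) one_pos ω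
    -- Strictly decreasing from `2` towards `1`: every stage may lose a little mass, radius range
    -- and ball bound, with total loss at most a factor `2` in each.
    let a : ℕ → ℝ≥0 := fun n => 1 + 2⁻¹ ^ n
    have ha1 : ∀ n, 1 ≤ a n := fun n => le_self_add
    have ha0 : ∀ n, 0 < a n := fun n => one_pos.trans_le (ha1 n)
    have ha : ∀ n, a (n + 1) < a n := fun n => by
      refine add_lt_add_right (pow_lt_pow_right_of_lt_one₀ (by norm_num) ?_ n.lt_succ_self) 1
      rw [← NNReal.coe_lt_coe]; push_cast; norm_num
    let P : ℕ → Measure E × Set E → Prop := fun n p => (∃ C : ℝ≥0, p.1 ≤ C • volume) ∧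
      IsOpen p.2 ∧ p.2 ⊆ O ∧ p.1 p.2ᶜ = 0 ∧ a n * (V / 2) ≤ p.1 univ ∧
      ∀ (y : E) (r : ℝ≥0), 0 < r → r ≤ a n * (s / 2) → p.1 (ball y r) ≤ (η / a n * f r : ℝ≥0)
    have hstart : P 0 (volume.restrict O, O) := by
      have ha2 : a 0 = 2 := by simp only [a, pow_zero]; norm_num
      refine ⟨⟨1, ?_⟩, hO, subset_rfl, ?_, ?_, ?_⟩
      · rw [one_smul]; exact Measure.restrict_le_self
      · rw [Measure.restrict_apply hO.measurableSet.compl]; simp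
      · rw [ha2, Measure.restrict_apply_univ]
        exact (ENNReal.mul_div_cancel (by simp) (by simp)).le
      · intro y r hr hrs
        rw [ha2, mul_div_cancel₀ _ (two_ne_zero' ℝ≥0)] at hrs
        rw [ha2]
        calc volume.restrict O (ball y r) ≤ volume (ball y r) := Measure.restrict_le_self _
          _ = (ω * r ^ finrank ℝ E : ℝ≥0) := by
              rw [volume_ball_nnreal, ← hω']; push_cast; ring
          _ ≤ _ := by exact_mod_cast hsf r hr hrs
    have hstep : ∀ n p, P n p → ∃ q, P (n + 1) q ∧ closure q.2 ⊆ p.2 ∩ A n := by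
      rintro n ⟨μ, U⟩ ⟨⟨C, hC⟩, hUo, hUO, hμU, hmass, hball⟩
      have := isFiniteMeasure_of_le_smul_volume hC (hOb.subset hUO) hμU
      have hlt : a (n + 1) * (V / 2) < μ univ := by
        refine lt_of_lt_of_le ?_ hmass
        rw [ENNReal.mul_lt_mul_iff_left (by simpa using hV0) (ENNReal.div_ne_top hVt (by simp))]
        exact_mod_cast ha n
      obtain ⟨ν, U', hν, hU', hνU', hcl, hM, hb⟩ := exists_averaged_redistribution hf hfm hfpos
        hbig hr₀ hC (hred n μ C U hUo hUO hC hμU _ hlt) (M₀ := η / a n) (M₁ := η / a (n + 1))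
        (div_lt_div_of_pos_left hη (ha0 _) (ha n))
        (mul_lt_mul_of_pos_right (ha n) (half_pos hs)) hball
      exact ⟨(ν, U'), ⟨hν, hU', (subset_closure.trans hcl).trans (inter_subset_left.trans hUO),
        hνU', hM, hb⟩, hcl⟩
    choose! nxt hnxt hnxt' using hstep
    let p : ℕ → Measure E × Set E := fun n => Nat.rec (volume.restrict O, O) nxt n
    have hp : ∀ n, P n (p n) := fun n => by
      induction n with
      | zero => exact hstart
      | succ n ih => exact hnxt n _ ih
    have hcl : ∀ n, closure (p (n + 1)).2 ⊆ (p n).2 ∩ A n := fun n => hnxt' n _ (hp n)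
    have hcompact : ∀ n, IsCompact (closure (p n).2) := fun n =>
      Metric.isCompact_of_isClosed_isBounded isClosed_closure (hOb.subset (hp n).2.2.1).closure
    have hanti : Antitone fun n => closure (p n).2 := antitone_nat_of_succ_le fun n =>
      (hcl n).trans (inter_subset_left.trans subset_closure)
    have hsub : ⋂ n, closure (p n).2 ⊆ O ∩ ⋂ n, A n := by
      intro x hx
      have hx' := fun n => hcl n (mem_iInter.1 hx (n + 1))
      exact ⟨(hp 0).2.2.1 (hx' 0).1, mem_iInter.2 fun n => (hx' n).2⟩
    rw [mul_comm, ← ENNReal.div_le_iff_le_mul (Or.inl (by simpa using hη.ne')) (Or.inl (by simp))]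
    refine le_trans ?_ (le_iSup₂_of_le (s / 2) (half_pos hs) le_rfl)
    refine le_iInf fun x => le_iInf fun r => le_iInf fun hr => le_iInf fun hF => ?_
    rw [ENNReal.div_le_iff_le_mul (Or.inl (by simpa using hη.ne')) (Or.inl (by simp))]
    -- By compactness an open cover of the limit set already covers a finite stage, so no limit
    -- measure is needed.
    obtain ⟨n, hn⟩ := exists_subset_nhds_of_isCompact' hanti.directed_ge hcompact
      (fun n => isClosed_closure) (U := ⋃ i, ball (x i) (r i))
      (fun y hy => (isOpen_iUnion fun i => isOpen_ball).mem_nhds (hF (hsub hy)))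
    obtain ⟨-, -, -, hnull, hmass, hball⟩ := hp n
    calc V / 2 ≤ a n * (V / 2) := le_mul_of_one_le_left zero_le (by exact_mod_cast ha1 n)
      _ ≤ (p n).1 univ := hmass
      _ ≤ (p n).1 (⋃ i, ball (x i) (r i)) + (p n).1 (p n).2ᶜ := by
          refine (measure_mono ?_).trans (measure_union_le _ _)
          intro y _
          by_cases hy : y ∈ (p n).2
          · exact Or.inl (hn (subset_closure hy))
          · exact Or.inr hy
      _ = (p n).1 (⋃ i, ball (x i) (r i)) := by rw [hnull, add_zero]
      _ ≤ ∑' i, (p n).1 (ball (x i) (r i)) := measure_iUnion_le _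
      _ ≤ ∑' i, (f (r i) : ℝ≥0∞) * η := by
          refine ENNReal.tsum_le_tsum fun i => ?_
          rcases eq_or_lt_of_le (zero_le (a := r i)) with h0 | h0
          · simp [← h0]
          · refine (hball (x i) (r i) h0
              ((hr i).trans (le_mul_of_one_le_left zero_le (ha1 n)))).trans ?_
            rw [mul_comm, ← ENNReal.coe_mul, ENNReal.coe_le_coe]
            gcongr
            exact div_le_self zero_le (ha1 n)
      _ = _ := ENNReal.tsum_mul_right
  by_contra hH
  set H := hausdorffMeas f (O ∩ ⋂ n, A n)
  have hV2 : V / 2 ≠ 0 := by simpa using hV0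
  obtain ⟨η, hη0, hη⟩ := ENNReal.exists_nnreal_pos_mul_lt hH hV2
  exact absurd (key η hη0) (not_le.2 hη)

end FullMeasure

/-! ### The two regimes for families of planes -/

section PlaneFamilies

variable {E : Type*} [NormedAddCommGroup E] [InnerProductSpace ℝ E] [FiniteDimensional ℝ E]
  [MeasurableSpace E] [BorelSpace E] [Nontrivial E]

theorem IsBall.isBounded {X : Type*} [PseudoMetricSpace X] {B : Set X} (hB : IsBall B) :
    Bornology.IsBounded B := by
  obtain ⟨x, r, -, rfl | rfl⟩ := hB
  · exact isBounded_ball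
  · exact isBounded_closedBall

theorem IsBall.exists_ball_subset {X : Type*} [PseudoMetricSpace X] {B : Set X} (hB : IsBall B) :
    ∃ (x : X) (r : ℝ), 0 < r ∧ ball x r ⊆ B := by
  obtain ⟨x, r, hr, rfl | rfl⟩ := hB
  · exact ⟨x, r, hr, subset_rfl⟩
  · exact ⟨x, r, hr, ball_subset_closedBall⟩

theorem IsBall.measurableSet {X : Type*} [PseudoMetricSpace X] [MeasurableSpace X]
    [OpensMeasurableSpace X] {B : Set X} (hB : IsBall B) : MeasurableSet B := by
  obtain ⟨x, r, -, rfl | rfl⟩ := hB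
  · exact measurableSet_ball
  · exact measurableSet_closedBall

theorem volume_sdiff_eq_zero_of_hausdorffMeas_pow_eq {B L : Set E} (hB : IsBall B)
    (hL : MeasurableSet L)
    (h : hausdorffMeas (fun r => r ^ finrank ℝ E) (B ∩ L) =
      hausdorffMeas (fun r => r ^ finrank ℝ E) B) : volume (B \ L) = 0 := by
  have hBt : volume B ≠ ∞ := hB.isBounded.measure_lt_top.ne
  have hBLt : volume (B ∩ L) ≠ ∞ := measure_ne_top_of_subset inter_subset_left hBt
  have h1 : volume (B ∩ L) = volume B := by
    rw [← mul_hausdorffMeas_pow_eq hBt, ← mul_hausdorffMeas_pow_eq hBLt, h]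
  have h2 := measure_inter_add_sdiff (μ := volume) B hL
  rw [h1] at h2
  exact (ENNReal.add_right_inj hBt).1 (h2.trans (add_zero _).symm)

theorem IsDimensionFunction.map_zero {f : ℝ≥0 → ℝ≥0} (hf : IsDimensionFunction f) : f 0 = 0 :=
  tendsto_nhds_unique ((hf.continuous.tendsto 0).mono_left nhdsWithin_le_nhds) hf.tendsto_zero

theorem IsDimensionFunction.finite_lt_comp {g : ℝ≥0 → ℝ≥0} (hg : IsDimensionFunction g)
    {J : Type*} {a : J → ℝ≥0} (ha : ∀ ε, 0 < ε → {α | ε < a α}.Finite) {ε : ℝ≥0} (hε : 0 < ε) :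
    {α | ε < g (a α)}.Finite := by
  have h1 : ∀ᶠ r in 𝓝[>] (0 : ℝ≥0), g r < ε := hg.tendsto_zero.eventually_lt_const hε
  obtain ⟨s, hsε, hs⟩ := (h1.and self_mem_nhdsWithin).exists
  refine (ha s hs).subset fun α hα => ?_
  by_contra hle
  exact absurd (hα.trans_le (hg.monotone (not_lt.1 hle))) hsε.not_gt

/-- Here `b ^ m = g a ≤ K * a ^ m` for small `a`, so `b ≤ M * a` with `M = K + 1`, since `K ≤ M ≤ M
^ m`. The factor `M` is then removed up to a null set. -/
theorem hausdorffMeas_inter_limsupSet_eq_of_le {f g : ℝ≥0 → ℝ≥0} {l m : ℕ} (hm : m ≠ 0)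
    (hd : finrank ℝ E = m + l) (hf0 : f 0 = 0) (hg0 : g 0 = 0)
    (hgf : ∀ r, 0 < r → g r = (r ^ l)⁻¹ * f r) {K s : ℝ≥0} (hs : 0 < s)
    (hK : ∀ r, 0 < r → r ≤ s → f r ≤ K * r ^ (m + l)) {J : Type*} [Countable J] [Infinite J]
    (R : J → Set E) {a b : J → ℝ≥0} (ha : ∀ ε, 0 < ε → {α | ε < a α}.Finite)
    (hb : ∀ α, b α ^ m = g (a α)) {B : Set E} (hB : volume (B \ limsupSet R b) = 0) :
    hausdorffMeas f (B ∩ limsupSet R a) = hausdorffMeas f B := by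
  refine hausdorffMeas_inter_eq_of_ae hf0 hs (c := K) (by rwa [hd]) ?_
  set M : ℝ≥0 := K + 1 with hM
  have hsub : limsupSet R b ⊆ limsupSet R fun α => M * a α := by
    refine limsupSet_subset_of_finite ((ha s hs).subset fun α hα => ?_)
    by_contra hle
    refine hα ?_
    rw [← pow_le_pow_iff_left₀ zero_le zero_le hm, hb]
    rcases eq_or_lt_of_le (zero_le (a := a α)) with h0 | h0
    · rw [← h0, hg0]; exact zero_le
    · rw [hgf _ h0]
      calc (a α ^ l)⁻¹ * f (a α) ≤ (a α ^ l)⁻¹ * (K * a α ^ (m + l)) := by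
            gcongr; exact hK _ h0 (not_lt.1 hle)
        _ = K * a α ^ m := by rw [pow_add]; field_simp
        _ ≤ M ^ m * a α ^ m := by
            gcongr
            exact le_trans le_self_add (le_self_pow₀ (a := M) le_add_self hm)
        _ = _ := (mul_pow _ _ _).symm
  have hae := limsupSet_const_mul_ae_eq (volume : Measure E) R ha (M := M) (by positivity)
  have h1 : volume (B \ limsupSet R fun α => M * a α) = 0 :=
    measure_mono_null (sdiff_subset_sdiff_right hsub) hB
  rw [← h1]
  exact measure_congr (ae_eq_set_sdiff (ae_eq_refl B) hae.symm)

theorem hausdorffMeas_inter_limsupSet_eq_top {f g : ℝ≥0 → ℝ≥0} {l m : ℕ} (hm : m ≠ 0)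
    (hd : finrank ℝ E = m + l) (hf : IsDimensionFunction f) (hg : IsDimensionFunction g)
    (hgf : ∀ r, 0 < r → g r = (r ^ l)⁻¹ * f r)
    (hanti : AntitoneOn (fun r : ℝ≥0 => (r ^ (m + l))⁻¹ * f r) (Ioi 0))
    (hbig : ∀ K : ℝ≥0, ∃ s, 0 < s ∧ ∀ r, 0 < r → r ≤ s → K * r ^ (m + l) ≤ f r)
    {J : Type*} [Countable J] (R : J → AffineSubspace ℝ E)
    (hR : ∀ α, finrank ℝ (R α).direction = l) {a b : J → ℝ≥0}
    (ha : ∀ ε, 0 < ε → {α | ε < a α}.Finite) (hb : ∀ α, b α ^ m = g (a α)) {B : Set E}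
    (hB : IsBall B) (hBv : volume (B \ limsupSet (fun α => (R α : Set E)) b) = 0) :
    hausdorffMeas f (B ∩ limsupSet (fun α => (R α : Set E)) a) = ∞ := by
  have hf0 := hf.map_zero
  have hg0 := hg.map_zero
  obtain ⟨x, ρ, hρ, hxB⟩ := hB.exists_ball_subset
  obtain ⟨e, he⟩ := exists_injective_nat J
  obtain ⟨r₀, hr₀, hr₀f⟩ := hbig 1
  have hfpos : ∀ r, 0 < r → 0 < f r := by
    intro r hr
    have h1 : 0 < min r r₀ := lt_min hr hr₀
    have h2 := hr₀f _ h1 (min_le_right _ _)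
    have h3 : 0 < 1 * min r r₀ ^ (m + l) := by positivity
    exact (h3.trans_le h2).trans_le (hf.monotone (min_le_left _ _))
  have hmul : ∀ r, r ^ l * g r = f r := by
    intro r
    rcases eq_or_lt_of_le (zero_le (a := r)) with h0 | h0
    · rw [← h0, hg0, hf0, mul_zero]
    · rw [hgf r h0]; field_simp
  have hfg : IsScalePair f g l m r₀ := by
    refine ⟨hg.monotone, hmul, fun r a hr hra => ?_, fun r hr => ?_⟩
    · have h0 : 0 < a := hr.trans_le hra
      have h1 : (a ^ (m + l))⁻¹ * f a ≤ (r ^ (m + l))⁻¹ * f r := hanti hr h0 hra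
      rw [add_comm l m]
      calc r ^ (m + l) * f a = r ^ (m + l) * a ^ (m + l) * ((a ^ (m + l))⁻¹ * f a) := by field_simp
        _ ≤ r ^ (m + l) * a ^ (m + l) * ((r ^ (m + l))⁻¹ * f r) := by gcongr
        _ = _ := by field_simp
    · rcases eq_or_lt_of_le (zero_le (a := r)) with h0 | h0
      · rw [← h0, zero_pow (by omega)]; exact zero_le
      · simpa [add_comm] using hr₀f r h0 hr
  have hRm : ∀ α, finrank ℝ (R α).directionᗮ = m := by
    intro α
    have := Submodule.finrank_add_finrank_orthogonal (R α).direction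
    rw [hR, hd] at this
    omega
  -- Multiplied by `a ^ l`, the inequality `a ^ m ≤ g a` becomes `a ^ (l + m) ≤ f a`.
  have hab : {α | ¬ a α ≤ b α}.Finite := by
    refine (ha r₀ hr₀).subset fun α hα => ?_
    by_contra hle
    refine hα ?_
    rw [← pow_le_pow_iff_left₀ zero_le zero_le hm, hb]
    rcases eq_or_lt_of_le (zero_le (a := a α)) with h0 | h0
    · rw [← h0, zero_pow hm]; exact zero_le
    · refine le_of_mul_le_mul_left ?_ (pow_pos h0 l)
      rw [hmul, ← pow_add]
      exact hfg.pow_le _ (not_lt.1 hle)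
  have hpos : ∀ α, 0 < b α → 0 < a α := by
    intro α hα
    by_contra h0
    have h1 := hb α
    rw [nonpos_iff_eq_zero.1 (not_lt.1 h0), hg0] at h1
    exact hα.ne' ((pow_eq_zero_iff hm).1 h1)
  have hb0 : ∀ ε, 0 < ε → {α | ε < b α}.Finite := by
    intro ε hε
    refine (hg.finite_lt_comp ha (pow_pos hε m)).subset fun α hα => ?_
    have : ε ^ m < b α ^ m := pow_lt_pow_left₀ hα zero_le hm
    rwa [hb] at this
  have htop := hausdorffMeas_inter_iInter_eq_top hf.continuous hf.monotone hfpos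
    (by rwa [hd]) hr₀ isOpen_ball isBounded_ball (nonempty_ball.2 hρ)
    (O := ball x ρ) (A := fun n => ⋃ α ∈ {α | e α < n}ᶜ, thickening (a α) (R α : Set E))
    (fun n μ _ C U hU hUO hμ hμU M hM δ hδ => exists_isRedistribution hfg R hR hRm hb hab hpos hb0
      hU (by
        refine measure_mono_null (fun y hy => ?_) hBv
        have hy' : ¬ (y ∈ U → y ∈ limsupSet (fun α => (R α : Set E)) b) := hy
        rw [Classical.not_imp] at hy'
        exact ⟨hxB (hUO hy'.1), hy'.2⟩)
      ((finite_lt_nat n).preimage he.injOn) hμ hμU hδ hM)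
  refine top_unique (htop.symm.le.trans (hausdorffMeas_mono (inter_subset_inter hxB ?_)))
  exact iInter_biUnion_subset_limsupSet e _ a

end PlaneFamilies

end PlaneMTP

/-! ### The mass transference principle for planes -/

theorem theorem3 (k m l : ℕ) (hm : 1 ≤ m) (hk : k = m + l)
    {J : Type*} [Countable J] [Infinite J]
    -- a family of `l`-dimensional planes and a non-negative function tending to zero
    (R : J → AffineSubspace ℝ (EuclideanSpace ℝ (Fin k)))
    (hR : ∀ α, Module.finrank ℝ (R α).direction = l)
    (Υ : J → ℝ≥0) (hΥ : ∀ ε : ℝ≥0, 0 < ε → {α : J | ε < Υ α}.Finite)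
    -- the transversal `m`-dimensional subspace `V`
    (V : Submodule ℝ (EuclideanSpace ℝ (Fin k))) (hV : Module.finrank ℝ V = m)
    (hVR : ∀ α, ((V : Set (EuclideanSpace ℝ (Fin k))) ∩
      (R α : Set (EuclideanSpace ℝ (Fin k)))).Nonempty)
    (hdiam : (⨆ α, Metric.ediam ((V : Set (EuclideanSpace ℝ (Fin k))) ∩
      Metric.thickening 1 (R α : Set (EuclideanSpace ℝ (Fin k))))) < ∞)
    -- the dimension functions `f` and `g : r ↦ r ^ (-l) * f r`
    (f g : ℝ≥0 → ℝ≥0) (hf : IsDimensionFunction f) (hg : IsDimensionFunction g)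
    (hgf : ∀ r, 0 < r → g r = (r ^ l)⁻¹ * f r)
    (hmono : MonotoneOn (fun r : ℝ≥0 => (r ^ k)⁻¹ * f r) (Set.Ioi 0) ∨
      AntitoneOn (fun r : ℝ≥0 => (r ^ k)⁻¹ * f r) (Set.Ioi 0))
    (Ω : Set (EuclideanSpace ℝ (Fin k))) (hΩ : IsBall Ω)
    (hfull : ∀ B : Set (EuclideanSpace ℝ (Fin k)), IsBall B → B ⊆ Ω →
      hausdorffMeas (fun r => r ^ k)
          (B ∩ limsupSet (fun α => (R α : Set (EuclideanSpace ℝ (Fin k))))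
            (fun α => g (Υ α) ^ (1 / m : ℝ))) =
        hausdorffMeas (fun r => r ^ k) B) :
    ∀ B : Set (EuclideanSpace ℝ (Fin k)), IsBall B → B ⊆ Ω →
      hausdorffMeas f
          (B ∩ limsupSet (fun α => (R α : Set (EuclideanSpace ℝ (Fin k)))) Υ) =
        hausdorffMeas f B := by
  have hpos : 0 < m + l := by omega
  have hd : Module.finrank ℝ (EuclideanSpace ℝ (Fin k)) = m + l := by
    rw [finrank_euclideanSpace_fin, hk]
  have : Nontrivial (EuclideanSpace ℝ (Fin k)) :=
    Module.nontrivial_of_finrank_pos (R := ℝ) (by rw [hd]; exact hpos)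
  have hm0 : m ≠ 0 := by omega
  have hdk : Module.finrank ℝ (EuclideanSpace ℝ (Fin k)) = k := finrank_euclideanSpace_fin
  intro B hB hBΩ
  have hb : ∀ α, (g (Υ α) ^ (1 / m : ℝ)) ^ m = g (Υ α) := fun α => by
    rw [one_div, NNReal.rpow_inv_natCast_pow _ hm0]
  have hBv := volume_sdiff_eq_zero_of_hausdorffMeas_pow_eq hB
    (measurableSet_limsupSet (fun α => (R α : Set (EuclideanSpace ℝ (Fin k))))
      (fun α => g (Υ α) ^ (1 / m : ℝ))) (by rw [hdk]; exact hfull B hB hBΩ)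
  by_cases hbd : ∃ K s : ℝ≥0, 0 < s ∧ ∀ r, 0 < r → r ≤ s → f r ≤ K * r ^ (m + l)
  · obtain ⟨K, s, hs, hK⟩ := hbd
    exact hausdorffMeas_inter_limsupSet_eq_of_le hm0 hd hf.map_zero hg.map_zero hgf hs hK _ hΥ hb
      hBv
  · have hlarge : ∀ K s : ℝ≥0, 0 < s → ∃ r, 0 < r ∧ r ≤ s ∧ K * r ^ (m + l) < f r := by
      intro K s hs
      by_contra hcon
      refine hbd ⟨K, s, hs, fun r hr hrs => ?_⟩
      by_contra hlt
      exact hcon ⟨r, hr, hrs, not_le.1 hlt⟩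
    rw [hk] at hmono
    -- A non-decreasing quotient would give `f r ≤ f 1 * r ^ k` on `(0, 1]`, which is the first
    -- regime.
    have hanti : AntitoneOn (fun r : ℝ≥0 => (r ^ (m + l))⁻¹ * f r) (Set.Ioi 0) := by
      refine hmono.resolve_left fun hinc => ?_
      obtain ⟨r, hr, hr1, hlt⟩ := hlarge (f 1) 1 one_pos
      have h1 : (r ^ (m + l))⁻¹ * f r ≤ (1 ^ (m + l))⁻¹ * f 1 := hinc hr (Set.mem_Ioi.2 one_pos) hr1
      rw [one_pow, inv_one, one_mul, inv_mul_le_iff₀ (by positivity), mul_comm] at h1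
      exact absurd h1 hlt.not_ge
    have hbig : ∀ K : ℝ≥0, ∃ s, 0 < s ∧ ∀ r, 0 < r → r ≤ s → K * r ^ (m + l) ≤ f r := by
      intro K
      obtain ⟨s, hs, -, hlt⟩ := hlarge K 1 one_pos
      refine ⟨s, hs, fun r hr hrs => ?_⟩
      have h1 : (s ^ (m + l))⁻¹ * f s ≤ (r ^ (m + l))⁻¹ * f r := hanti hr hs hrs
      have h2 : K ≤ (s ^ (m + l))⁻¹ * f s := by
        rw [le_inv_mul_iff₀ (by positivity), mul_comm]
        exact hlt.le
      have h3 := h2.trans h1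
      rwa [le_inv_mul_iff₀ (by positivity), mul_comm] at h3
    have htop := hausdorffMeas_inter_limsupSet_eq_top hm0 hd hf hg hgf hanti hbig R hR hΥ hb hB hBv
    rw [htop]
    exact (top_unique (htop.symm.le.trans (hausdorffMeas_mono Set.inter_subset_left))).symm
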